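/- Let $N\ge 3$, $2^*:=\frac{2N}{N-2}$, write $x=(y,z)\in\mathbb R^2\times\mathbb R^{N-2}\equiv\mathbb R^N$, let $\Omega:=(\mathbb R^2\smallsetminus\{0\})\times\mathbb R^{N-2}$, and let $\mathbb A(y,z):=|y|^{-2}(-y_2,y_1,0)$ be the Aharonov–Bohm potential on $\Omega$. Let $s,\sigma\in\mathbb R$, and let $\kappa_s$ be the best (largest) constant in the Hardy inequality $$\kappa_s\int_\Omega\frac{|\varphi|^2}{|y|^2}\le\int_\Omega|\nabla\varphi+is\mathbb A\varphi|^2\qquad\forall\varphi\in C_c^\infty(\Omega,\mathbb C).$$ For $\mathbb K\in\{\mathbb R,\mathbb C\}$ let $D^{1,2}_{s\mathbb A,0}(\Omega,\mathbb K)$ be the closure of $C_c^\infty(\Omega,\mathbb K)$ with respect to the norm $\left(\int_\Omega|\nabla u+is\mathbb Au|^2\right)^{1/2}$ (a space of functions in $L^{2^*}(\Omega)$, identified if they agree almost everywhere), and put $$\|u\|_{s\mathbb A,\sigma}^2:=\int_\Omega|\nabla u+is\mathbb Au|^2-\sigma\int_\Omega\frac{|u|^2}{|y|^2},\qquad |u|_{2^*}:=\Big(\int_\Omega|u|^{2^*}\Big)^{1/2^*},$$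 where $\|u\|_{s\mathbb A,\sigma}^2:=+\infty$ if $\sigma<0$ and $\int_\Omega|u|^2/|y|^2=\infty$. Let $\Gamma$ be a subgroup of the group $O(N-2)$ of linear isometries of $\mathbb R^{N-2}$, and let $G:=\mathbb S^1\times\Gamma$ act on $\mathbb R^N$ by $(c,h)(y,z):=(cy,hz)$, where $\mathbb S^1$ is the group of unit complex numbers and $\mathbb R^2\equiv\mathbb C$. Let $D^{1,2}_{s\mathbb A,0}(\Omega,\mathbb K)^G$ be the set of the $u\in D^{1,2}_{s\mathbb A,0}(\Omega,\mathbb K)$ that are $G$-invariant, i.e. for every $g\in G$, $u(gx)=u(x)$ for almost every $x\in\Omega$. If $\sigma<\kappa_s$, then $$\inf_{\substack{u\in D^{1,2}_{s\mathbb A,0}(\Omega,\mathbb C)^G\\u\ne0}}\frac{\|u\|^2_{s\mathbb A,\sigma}}{|u|^2_{2^*}}=\inf_{\substack{u\in D^{1,2}_{s\mathbb A,0}(\Omega,\mathbb R)^G\\u\ne0}}\frac{\|u\|^2_{s\mathbb A,\sigma}}{|u|^2_{2^*}}.$$ Moreover, if $u$ is a minimizer for the left-hand side, then $|u|$ is a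 minimizer for the right-hand side; in particular, $|u|\in D^{1,2}_{s\mathbb A,0}(\Omega,\mathbb R)^G$. -/

import Mathlib

open MeasureTheory Filter Topology
open scoped ContDiff

namespace AharonovBohm

noncomputable section

/-- `ℝ^N = ℝ² × ℝ^(N-2)` with the Euclidean norm: the coordinates `Sum.inl 0`, `Sum.inl 1` are
those of `y ∈ ℝ²`, the coordinates `Sum.inr j` are those of `z ∈ ℝ^(N-2)`. -/
abbrev Space (N : ℕ) : Type := EuclideanSpace ℝ (Fin 2 ⊕ Fin (N - 2))

variable {N : ℕ}

/-- The component `y` of `x = (y, z)`, as a point of `ℂ ≡ ℝ²`. -/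
def yPart (x : Space N) : ℂ := ⟨x (Sum.inl 0), x (Sum.inl 1)⟩

/-- The component `z` of `x = (y, z)`. -/
def zPart (x : Space N) : EuclideanSpace ℝ (Fin (N - 2)) :=
  WithLp.toLp 2 fun j => x (Sum.inr j)

/-- The domain `Ω = (ℝ² ∖ {0}) × ℝ^(N-2)`. -/
def Omega (N : ℕ) : Set (Space N) := {x | yPart x ≠ 0}

/-- The Aharonov-Bohm potential `𝔸(y, z) = |y|⁻² (-y₂, y₁, 0)`. -/
def potential (x : Space N) : Space N :=
  WithLp.toLp 2 (Sum.elim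
    ![-(yPart x).im / ‖yPart x‖ ^ 2, (yPart x).re / ‖yPart x‖ ^ 2] fun _ => 0)

/-- The critical Sobolev exponent `2* = 2N / (N - 2)`. -/
def critExp (N : ℕ) : ℝ := 2 * (N : ℝ) / ((N : ℝ) - 2)

/-- `C_c^∞(Ω, 𝕜)` for `𝕜 = ℝ` or `𝕜 = ℂ`. -/
def IsTest {𝕜 : Type} [NormedAddCommGroup 𝕜] [NormedSpace ℝ 𝕜] (φ : Space N → 𝕜) : Prop :=
  ContDiff ℝ ∞ φ ∧ HasCompactSupport φ ∧ tsupport φ ⊆ Omega N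

/-- The classical gradient `∇φ = (∂₁φ, …, ∂_Nφ)` of a complex-valued function. -/
def grad (φ : Space N → ℂ) (x : Space N) : EuclideanSpace ℂ (Fin 2 ⊕ Fin (N - 2)) :=
  WithLp.toLp 2 fun j => fderiv ℝ φ x (EuclideanSpace.single j 1)

/-- `v` is the weak (distributional) gradient of `u` in `Ω`. -/
def IsWeakGrad (u : Space N → ℂ) (v : Space N → EuclideanSpace ℂ (Fin 2 ⊕ Fin (N - 2))) : Prop :=
  LocallyIntegrableOn u (Omega N) ∧ LocallyIntegrableOn v (Omega N) ∧
    ∀ ψ : Space N → ℝ, IsTest ψ → ∀ j,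
      ∫ x in Omega N, ((fderiv ℝ ψ x (EuclideanSpace.single j 1) : ℝ) : ℂ) * u x
        = - ∫ x in Omega N, ((ψ x : ℝ) : ℂ) * v x j

open Classical in
/-- The weak gradient of `u` in `Ω` (unique up to null sets), and `0` if there is none. -/
def weakGrad (u : Space N → ℂ) : Space N → EuclideanSpace ℂ (Fin 2 ⊕ Fin (N - 2)) :=
  if h : ∃ v, IsWeakGrad u v then h.choose else 0

/-- The term `i s 𝔸 u`. -/
def magneticTerm (s : ℝ) (u : Space N → ℂ) (x : Space N) :
    EuclideanSpace ℂ (Fin 2 ⊕ Fin (N - 2)) :=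
  WithLp.toLp 2 fun j => Complex.I * (s : ℂ) * ((potential x j : ℝ) : ℂ) * u x

/-- `∇φ + i s 𝔸 φ` with the classical gradient (used for test functions). -/
def testCovGrad (s : ℝ) (φ : Space N → ℂ) (x : Space N) :
    EuclideanSpace ℂ (Fin 2 ⊕ Fin (N - 2)) :=
  grad φ x + magneticTerm s φ x

/-- `∇u + i s 𝔸 u` with the weak gradient. -/
def covGrad (s : ℝ) (u : Space N → ℂ) (x : Space N) :
    EuclideanSpace ℂ (Fin 2 ⊕ Fin (N - 2)) :=
  weakGrad u x + magneticTerm s u x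

/-- The best constant `κ_s` in the Hardy inequality
`κ ∫_Ω |φ|² / |y|² ≤ ∫_Ω |∇φ + i s 𝔸 φ|²` for all `φ ∈ C_c^∞(Ω, ℂ)`. -/
def hardyConst (N : ℕ) (s : ℝ) : ℝ :=
  sSup {κ : ℝ | ∀ φ : Space N → ℂ, IsTest φ →
    κ * ∫ x in Omega N, ‖φ x‖ ^ 2 / ‖yPart x‖ ^ 2 ≤ ∫ x in Omega N, ‖testCovGrad s φ x‖ ^ 2}

/-- The `L^{2*}(Ω)`-norm. -/
def critNorm (u : Space N → ℂ) : ℝ :=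
  (eLpNorm u (ENNReal.ofReal (critExp N)) (volume.restrict (Omega N))).toReal

/-- `u` lies in the closure of a set `T` of test functions with respect to the norm
`‖u‖_{s𝔸} = (∫_Ω |∇u + i s 𝔸 u|²)^{1/2}`. By Sobolev's inequality, that abstract closure is a space
of functions in `L^{2*}(Ω)`, convergence in `‖·‖_{s𝔸}` implying convergence in `L^{2*}(Ω)`. -/
def MemClosure (s : ℝ) (T : Set (Space N → ℂ)) (u : Space N → ℂ) : Prop :=
  MemLp u (ENNReal.ofReal (critExp N)) (volume.restrict (Omega N)) ∧
  (∃ v, IsWeakGrad u v) ∧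
  ∃ φ : ℕ → Space N → ℂ, (∀ n, φ n ∈ T) ∧
    Tendsto (fun n => eLpNorm (fun x => φ n x - u x) (ENNReal.ofReal (critExp N))
      (volume.restrict (Omega N))) atTop (𝓝 0) ∧
    Tendsto (fun n => eLpNorm (fun x => testCovGrad s (φ n) x - covGrad s u x) 2
      (volume.restrict (Omega N))) atTop (𝓝 0)

/-- A real-valued function regarded as a complex-valued one. -/
def toComplex (u : Space N → ℝ) : Space N → ℂ := fun x => (u x : ℂ)

/-- `D^{1,2}_{s𝔸,0}(Ω, ℂ)`: the closure of `C_c^∞(Ω, ℂ)` (functions representing its elements). -/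
def DComplex (N : ℕ) (s : ℝ) : Set (Space N → ℂ) :=
  {u | MemClosure s {φ | IsTest φ} u}

/-- `D^{1,2}_{s𝔸,0}(Ω, ℝ)`: the closure of `C_c^∞(Ω, ℝ)` (functions representing its elements). -/
def DReal (N : ℕ) (s : ℝ) : Set (Space N → ℝ) :=
  {u | MemClosure s {φ | ∃ ψ : Space N → ℝ, IsTest ψ ∧ φ = toComplex ψ} (toComplex u)}

/-- `O(m)`: the group of linear isometries of `ℝ^m`. -/
abbrev OrthGroup (m : ℕ) : Type := EuclideanSpace ℝ (Fin m) ≃ₗᵢ[ℝ] EuclideanSpace ℝ (Fin m)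

/-- The action `(c, h) (y, z) = (c y, h z)` of `S¹ × O(N-2)` on `ℝ^N`. -/
def act (c : Circle) (h : OrthGroup (N - 2)) (x : Space N) : Space N :=
  WithLp.toLp 2 (Sum.elim
    ![((c : ℂ) * yPart x).re, ((c : ℂ) * yPart x).im] fun j => h (zPart x) j)

/-- `u` is `S¹ × Γ`-invariant, i.e. a fixed point of the action of `S¹ × Γ` on functions
(which are identified if they agree almost everywhere in `Ω`). -/
def IsInvariant {α : Type} (Γ : Subgroup (OrthGroup (N - 2))) (u : Space N → α) : Prop :=
  ∀ c : Circle, ∀ h ∈ Γ, ∀ᵐ x ∂(volume.restrict (Omega N)), u (act c h x) = u x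

/-- `‖u‖²_{s𝔸,σ} = ∫_Ω |∇u + i s 𝔸 u|² - σ ∫_Ω |u|² / |y|²`. On `D^{1,2}_{s𝔸,0}(Ω, ℂ)` with
`σ < κ_s` the first integral is finite, and the second one is finite if `σ > 0`; the second one can
be infinite if `σ < 0`, and then the value is `+∞`. -/
def energy (s σ : ℝ) (u : Space N → ℂ) : EReal :=
  ((∫⁻ x in Omega N, ‖covGrad s u x‖ₑ ^ 2 : ENNReal) : EReal) -
    (σ : EReal) *
      ((∫⁻ x in Omega N, ENNReal.ofReal (‖u x‖ ^ 2 / ‖yPart x‖ ^ 2) : ENNReal) : EReal)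

/-- The quotient `‖u‖²_{s𝔸,σ} / |u|²_{2*}`. -/
def quotient (s σ : ℝ) (u : Space N → ℂ) : EReal :=
  energy s σ u / ((critNorm u ^ 2 : ℝ) : EReal)

/-- The nonzero elements of `D^{1,2}_{s𝔸,0}(Ω, ℂ)^G`, `G = S¹ × Γ`. -/
def admissibleComplex (s : ℝ) (Γ : Subgroup (OrthGroup (N - 2))) : Set (Space N → ℂ) :=
  {u | u ∈ DComplex N s ∧ IsInvariant Γ u ∧ ¬ u =ᵐ[volume.restrict (Omega N)] 0}

/-- The nonzero elements of `D^{1,2}_{s𝔸,0}(Ω, ℝ)^G`, `G = S¹ × Γ`. -/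
def admissibleReal (s : ℝ) (Γ : Subgroup (OrthGroup (N - 2))) : Set (Space N → ℝ) :=
  {u | u ∈ DReal N s ∧ IsInvariant Γ u ∧ ¬ u =ᵐ[volume.restrict (Omega N)] 0}

/-- `S^G_{s𝔸,σ}`: the infimum of the quotient over the complex-valued functions. -/
def infComplex (s σ : ℝ) (Γ : Subgroup (OrthGroup (N - 2))) : EReal :=
  ⨅ u ∈ admissibleComplex s Γ, quotient s σ u

/-- The infimum of the quotient over the real-valued functions. -/
def infReal (s σ : ℝ) (Γ : Subgroup (OrthGroup (N - 2))) : EReal :=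
  ⨅ u ∈ admissibleReal s Γ, quotient s σ (toComplex u)

end

end AharonovBohm

namespace AharonovBohm

/-! ### Dominated convergence and multiplication by bounded functions in `L^p` -/

/-! Real-valued functions are complex-valued, so only one inequality needs proof: for invariant `u`,
the modulus `|u|` is admissible and its quotient is at most that of `u`.

Invariance under the circle makes `∇u` orthogonal to the direction of rotation, hence to `𝔸`
(`IsWeakGrad.angular_eq_zero`). So `|∇u + is𝔸u|² = |∇u|² + s²|u|²/|y|²`. The same splitting holds
for `|u|`, because `∇|u|` is real and `is𝔸|u|` is imaginary. As `|∇|u|| ≤ |∇u|` and the remaining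
terms of the quotient see only `|u|`, the quotient does not increase.

The work lies in showing that `|u|` is a limit of real test functions in the magnetic norm. The
approximants `φₙ` of `u` need not be invariant, so the splitting fails for them. Still, `√(|φₙ|² +
ε²) - ε` is a real test function whose gradient depends only on the covariant gradient of `φₙ`,
since `isAφₙ` is pointwise real-orthogonal to `φₙ`. Letting `n → ∞` and then `ε → 0` gives `|u|` as
a limit in the norm without potential (`isRealLimit_norm`). To restore the potential, `|u|` is cut
off near `y = 0` and near infinity, where boundedness of `𝔸` on the support makes both norms
comparable (`IsRealLimit.mul_left`). The cut-offs are then removed by dominated convergence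
(`IsRealLimit.of_cutoff`): their gradients are bounded by `C/|y|`, and the splitting for `u` gives
`|s||u|/|y| ≤ |∇u + is𝔸u| ∈ L²`. -/

theorem tendsto_eLpNorm_zero_of_dominated {α E F : Type*} [MeasurableSpace α] {μ : Measure α}
    [NormedAddCommGroup E] [NormedAddCommGroup F] {p : ENNReal} (hp0 : p ≠ 0) (hp : p ≠ ⊤)
    {f : ℕ → α → E} {g : α → F} (hf : ∀ n, AEStronglyMeasurable (f n) μ) (hg : MemLp g p μ)
    (hfg : ∀ n, ∀ᵐ x ∂μ, ‖f n x‖ ≤ ‖g x‖)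
    (hlim : ∀ᵐ x ∂μ, Tendsto (fun n => f n x) atTop (𝓝 0)) :
    Tendsto (fun n => eLpNorm (f n) p μ) atTop (𝓝 0) := by
  have hpos : 0 < p.toReal := ENNReal.toReal_pos hp0 hp
  have key : Tendsto (fun n => ∫⁻ x, ‖f n x‖ₑ ^ p.toReal ∂μ) atTop (𝓝 (∫⁻ _, 0 ∂μ)) := by
    refine tendsto_lintegral_of_dominated_convergence' (fun x => ‖g x‖ₑ ^ p.toReal)
      (fun n => (hf n).enorm.pow_const _) (fun n => ?_) ?_ ?_
    · filter_upwards [hfg n] with x hx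
      exact ENNReal.rpow_le_rpow (enorm_le_iff_norm_le.2 hx) hpos.le
    · exact (lintegral_rpow_enorm_lt_top_of_eLpNorm_lt_top hp0 hp hg.2).ne
    · filter_upwards [hlim] with x hx
      have h1 : Tendsto (fun n => ‖f n x‖ₑ) atTop (𝓝 0) := by simpa using hx.enorm
      simpa [hpos] using h1.ennrpow_const p.toReal
  simp only [lintegral_zero] at key
  have h2 := key.ennrpow_const (1 / p.toReal)
  rw [ENNReal.zero_rpow_of_pos (by positivity)] at h2
  refine h2.congr fun n => ?_
  rw [eLpNorm_eq_lintegral_rpow_enorm_toReal hp0 hp]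

/-- Hölder's inequality on a set of finite measure. The constant is chosen before the functions, so
it serves a whole sequence at once. -/
theorem exists_eLpNorm_le_of_bound {α : Type*} [MeasurableSpace α] {μ : Measure α}
    {p q : ENNReal} (hqp : q ≤ p) (hq : q ≠ 0) {K : Set α} (hKm : MeasurableSet K)
    (hK : μ K ≠ ⊤) (M : ℝ) :
    ∃ C : ENNReal, C ≠ ⊤ ∧ ∀ {E F : Type} [NormedAddCommGroup E] [NormedAddCommGroup F]
      (g : α → E) (f : α → F), AEStronglyMeasurable f μ → (∀ x ∈ K, ‖g x‖ ≤ M * ‖f x‖) →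
        (∀ x ∉ K, g x = 0) → eLpNorm g q μ ≤ C * eLpNorm f p μ := by
  have hexp : 0 ≤ 1 / q.toReal - 1 / p.toReal := by
    -- For `p = ⊤` the term `1 / p.toReal` is `1 / 0 = 0`, which is the right value.
    rcases eq_or_ne p ⊤ with rfl | hp
    · simp
    · have hq' : q ≠ ⊤ := ne_top_of_le_ne_top hp hqp
      have h0 : 0 < q.toReal := ENNReal.toReal_pos hq hq'
      have h1 : q.toReal ≤ p.toReal := ENNReal.toReal_mono hp hqp
      have := one_div_le_one_div_of_le h0 h1
      linarith
  refine ⟨ENNReal.ofReal M * μ K ^ (1 / q.toReal - 1 / p.toReal),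
    ENNReal.mul_ne_top ENNReal.ofReal_ne_top (ENNReal.rpow_ne_top_of_nonneg hexp hK), ?_⟩
  intro E F _ _ g f hf hfg hg0
  have hgK : g = K.indicator g := by
    ext x
    by_cases hx : x ∈ K
    · simp [hx]
    · simp [hx, hg0 x hx]
  calc eLpNorm g q μ = eLpNorm g q (μ.restrict K) := by
        conv_lhs => rw [hgK]
        exact eLpNorm_indicator_eq_eLpNorm_restrict hKm
    _ ≤ ENNReal.ofReal M * eLpNorm f q (μ.restrict K) := by
        refine eLpNorm_le_mul_eLpNorm_of_ae_le_mul ?_ q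
        filter_upwards [ae_restrict_mem hKm] with x hx using hfg x hx
    _ ≤ ENNReal.ofReal M * (eLpNorm f p (μ.restrict K) *
          (μ.restrict K) Set.univ ^ (1 / q.toReal - 1 / p.toReal)) := by
        gcongr
        exact eLpNorm_le_eLpNorm_mul_rpow_measure_univ hqp hf.restrict
    _ ≤ ENNReal.ofReal M * (eLpNorm f p μ * μ K ^ (1 / q.toReal - 1 / p.toReal)) := by
        rw [Measure.restrict_apply_univ]
        gcongr
        exact Measure.restrict_le_self
    _ = _ := by ring

theorem memLp_of_bound_of_support {α E : Type*} [MeasurableSpace α] {μ : Measure α}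
    [NormedAddCommGroup E] {f : α → E} {K : Set α} (hKm : MeasurableSet K) (hK : μ K ≠ ⊤)
    (hf : AEStronglyMeasurable f μ) {M : ℝ} (hM : ∀ x ∈ K, ‖f x‖ ≤ M) (h0 : ∀ x ∉ K, f x = 0)
    (p : ENNReal) : MemLp f p μ := by
  have hfK : f = K.indicator f := by
    ext x
    by_cases hx : x ∈ K
    · simp [hx]
    · simp [hx, h0 x hx]
  rw [hfK, memLp_indicator_iff_restrict hKm]
  have : IsFiniteMeasure (μ.restrict K) := ⟨by simpa using hK.lt_top⟩
  exact MemLp.of_bound hf.restrict M (by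
    filter_upwards [ae_restrict_mem hKm] with x hx using hM x hx)

theorem MemLp.of_tendsto_eLpNorm_sub {α E : Type*} [MeasurableSpace α] {μ : Measure α}
    [NormedAddCommGroup E] {p : ENNReal} {f : ℕ → α → E} {g : α → E}
    (hf : ∀ n, MemLp (f n) p μ) (hg : AEStronglyMeasurable g μ)
    (h : Tendsto (fun n => eLpNorm (fun x => f n x - g x) p μ) atTop (𝓝 0)) : MemLp g p μ := by
  obtain ⟨n, hn⟩ := (h.eventually (gt_mem_nhds (zero_lt_one' ENNReal))).exists
  have h1 : MemLp (fun x => f n x - g x) p μ :=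
    ⟨(hf n).1.sub hg, hn.trans ENNReal.one_lt_top⟩
  have h2 := (hf n).sub h1
  refine h2.ae_eq (Eventually.of_forall fun x => ?_)
  simp

/-! ### The domain and the potential -/

variable {N : ℕ}

theorem continuous_yPart : Continuous (yPart : Space N → ℂ) := by
  have : (yPart : Space N → ℂ) = fun x =>
      ((x (Sum.inl 0) : ℝ) : ℂ) + ((x (Sum.inl 1) : ℝ) : ℂ) * Complex.I := by
    ext x
    apply Complex.ext <;> simp [yPart]
  rw [this]
  fun_prop

theorem isOpen_Omega : IsOpen (Omega N) := isOpen_ne.preimage continuous_yPart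

theorem norm_yPart_sq (x : Space N) :
    ‖yPart x‖ ^ 2 = x (Sum.inl 0) ^ 2 + x (Sum.inl 1) ^ 2 := by
  rw [Complex.sq_norm, Complex.normSq_apply, yPart]
  ring

theorem norm_yPart_le (x : Space N) : ‖yPart x‖ ≤ ‖x‖ := by
  refine le_of_sq_le_sq ?_ (norm_nonneg _)
  rw [norm_yPart_sq, EuclideanSpace.real_norm_sq_eq, Fintype.sum_sum_type, Fin.sum_univ_two]
  have : 0 ≤ ∑ j : Fin (N - 2), x (Sum.inr j) ^ 2 := Finset.sum_nonneg fun _ _ => sq_nonneg _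
  linarith

theorem potential_inl_zero (x : Space N) :
    potential x (Sum.inl 0) = -x (Sum.inl 1) / ‖yPart x‖ ^ 2 := by
  simp [potential, yPart]

theorem potential_inl_one (x : Space N) :
    potential x (Sum.inl 1) = x (Sum.inl 0) / ‖yPart x‖ ^ 2 := by
  simp [potential, yPart]

theorem potential_inr (x : Space N) (j : Fin (N - 2)) : potential x (Sum.inr j) = 0 := by
  simp [potential]

/-- This is `|𝔸| = 1/|y|`. It persists at `y = 0`, where division by zero makes both sides vanish.
-/
theorem norm_magneticTerm_sq (s : ℝ) (u : Space N → ℂ) (x : Space N) :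
    ‖magneticTerm s u x‖ ^ 2 = (|s| * (‖u x‖ / ‖yPart x‖)) ^ 2 := by
  have h := norm_yPart_sq x
  rw [EuclideanSpace.norm_sq_eq, Fintype.sum_sum_type, Fin.sum_univ_two]
  simp only [magneticTerm, potential_inl_zero, potential_inl_one, potential_inr, norm_mul,
    Complex.norm_I, Complex.norm_real, Real.norm_eq_abs, mul_pow, sq_abs, div_pow]
  rcases eq_or_ne (yPart x) 0 with h0 | h0
  · simp [h0]
  · have : ‖yPart x‖ ≠ 0 := by simpa using h0
    field_simp
    simp
    linear_combination (-(s ^ 2 * ‖u x‖ ^ 2)) * h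

theorem norm_magneticTerm (s : ℝ) (u : Space N → ℂ) (x : Space N) :
    ‖magneticTerm s u x‖ = |s| * (‖u x‖ / ‖yPart x‖) :=
  (sq_eq_sq₀ (norm_nonneg _) (by positivity)).1 (norm_magneticTerm_sq s u x)

theorem measurable_potential : Measurable (potential : Space N → Space N) := by
  refine (WithLp.measurable_toLp 2 _).comp (measurable_pi_lambda _ fun j => ?_)
  have h := (continuous_yPart (N := N)).measurable
  have h1 : Measurable fun x : Space N => (yPart x).im := Complex.measurable_im.comp h
  have h2 : Measurable fun x : Space N => (yPart x).re := Complex.measurable_re.comp h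
  rcases j with j | j
  · fin_cases j
    · exact h1.neg.div (h.norm.pow_const 2)
    · exact h2.div (h.norm.pow_const 2)
  · exact measurable_const

theorem aestronglyMeasurable_magneticTerm {s : ℝ} {u : Space N → ℂ} {μ : Measure (Space N)}
    (hu : AEStronglyMeasurable u μ) : AEStronglyMeasurable (magneticTerm s u) μ := by
  refine AEMeasurable.aestronglyMeasurable ?_
  refine (WithLp.measurable_toLp 2 _).comp_aemeasurable (aemeasurable_pi_lambda _ fun j => ?_)
  have h1 : Measurable fun x : Space N => ((potential x j : ℝ) : ℂ) :=
    Complex.measurable_ofReal.comp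
      ((measurable_pi_apply j).comp ((WithLp.measurable_ofLp 2 _).comp measurable_potential))
  exact (h1.const_mul _).aemeasurable.mul hu.aemeasurable

/-! ### Test functions and weak gradients -/

theorem setIntegral_Omega_eq {E : Type*} [NormedAddCommGroup E] [NormedSpace ℝ E]
    {f : Space N → E} (hf : ∀ x ∉ Omega N, f x = 0) : ∫ x in Omega N, f x = ∫ x, f x :=
  setIntegral_eq_integral_of_forall_compl_eq_zero hf

theorem integrable_mul_of_tsupport_subset {b f : Space N → ℂ} (hb : Continuous b)
    (hc : HasCompactSupport b) (hs : tsupport b ⊆ Omega N) (hf : LocallyIntegrableOn f (Omega N)) :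
    Integrable (fun x => b x * f x) volume := by
  have h1 : IntegrableOn f (tsupport b) := hf.integrableOn_compact_subset hs hc
  have h2 : IntegrableOn (fun x => b x * f x) (tsupport b) :=
    h1.continuousOn_mul hb.continuousOn hc
  refine (integrableOn_iff_integrable_of_support_subset ?_).1 h2
  intro x hx
  refine subset_tsupport _ ?_
  intro h0
  exact hx (by simp [h0])

theorem IsTest.toComplex {ψ : Space N → ℝ} (h : IsTest ψ) : IsTest (toComplex ψ) := by
  refine ⟨Complex.ofRealCLM.contDiff.comp h.1, h.2.1.comp_left (g := Complex.ofReal) rfl, ?_⟩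
  exact (tsupport_comp_subset (g := Complex.ofReal) rfl ψ).trans h.2.2

theorem IsTest.memLp {𝕜 : Type} [NormedAddCommGroup 𝕜] [NormedSpace ℝ 𝕜] {φ : Space N → 𝕜}
    (h : IsTest φ) (p : ENNReal) (μ : Measure (Space N)) [IsFiniteMeasureOnCompacts μ] :
    MemLp φ p μ := h.1.continuous.memLp_of_hasCompactSupport h.2.1

theorem continuous_grad {φ : Space N → ℂ} (h : ContDiff ℝ ∞ φ) : Continuous (grad φ) := by
  have := h.continuous_fderiv (by simp)
  exact (PiLp.continuous_toLp 2 _).comp (continuous_pi fun j => this.clm_apply continuous_const)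

theorem grad_eq_zero_of_notMem {φ : Space N → ℂ} {x : Space N} (hx : x ∉ tsupport φ) :
    grad φ x = 0 := by
  have : fderiv ℝ φ x = 0 := by
    by_contra h
    exact hx (support_fderiv_subset ℝ h)
  ext j
  simp [grad, this]

theorem IsTest.partial {𝕜 : Type} [NormedAddCommGroup 𝕜] [NormedSpace ℝ 𝕜] {φ : Space N → 𝕜}
    (h : IsTest φ) (v : Space N) : IsTest (fun x => fderiv ℝ φ x v) := by
  have hs : tsupport (fun x => fderiv ℝ φ x v) ⊆ tsupport φ := tsupport_fderiv_apply_subset ℝ v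
  refine ⟨(h.1.fderiv_right (m := ∞) (by simp)).clm_apply contDiff_const, ?_, hs.trans h.2.2⟩
  exact h.2.1.of_isClosed_subset (isClosed_tsupport _) hs

/-- Integration by parts on the whole space: `ψ` and its derivatives vanish off `Ω`, so no boundary
term at `y = 0` arises. -/
theorem IsTest.isWeakGrad {φ : Space N → ℂ} (h : IsTest φ) : IsWeakGrad φ (grad φ) := by
  refine ⟨h.1.continuous.locallyIntegrable.locallyIntegrableOn _,
    (continuous_grad h.1).locallyIntegrable.locallyIntegrableOn _, ?_⟩
  intro ψ hψ j
  have hψ' := hψ.toComplex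
  set e : Space N := EuclideanSpace.single j 1
  have hd : ∀ x, fderiv ℝ (AharonovBohm.toComplex ψ) x e = ((fderiv ℝ ψ x e : ℝ) : ℂ) := by
    intro x
    have h1 : HasFDerivAt ψ (fderiv ℝ ψ x) x :=
      (hψ.1.differentiable (by simp) x).hasFDerivAt
    have h2 := (Complex.ofRealCLM.hasFDerivAt (x := ψ x)).comp x h1
    have h3 : fderiv ℝ (AharonovBohm.toComplex ψ) x = Complex.ofRealCLM.comp (fderiv ℝ ψ x) :=
      h2.fderiv
    rw [h3]
    rfl
  have hz : ∀ x ∉ Omega N, ψ x = 0 := fun x hx => image_eq_zero_of_notMem_tsupport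
    fun h' => hx (hψ.2.2 h')
  have hz' : ∀ x ∉ Omega N, fderiv ℝ ψ x e = 0 := fun x hx =>
    image_eq_zero_of_notMem_tsupport (f := fun x => fderiv ℝ ψ x e)
      fun h' => hx ((hψ.partial e).2.2 h')
  rw [setIntegral_Omega_eq (fun x hx => by simp [hz' x hx]),
    setIntegral_Omega_eq (fun x hx => by simp [hz x hx])]
  have hL : ∀ {f : Space N → ℂ}, IsTest f → LocallyIntegrableOn f (Omega N) := fun hf =>
    hf.1.continuous.locallyIntegrable.locallyIntegrableOn _
  have hI : ∀ {f g : Space N → ℂ}, IsTest f → IsTest g →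
      Integrable (fun x => f x * g x) volume := fun hf hg =>
    integrable_mul_of_tsupport_subset hf.1.continuous hf.2.1 hf.2.2 (hL hg)
  have := integral_mul_fderiv_eq_neg_fderiv_mul_of_integrable (μ := (volume : Measure (Space N)))
    (f := AharonovBohm.toComplex ψ) (g := φ) (v := e)
    (hI (hψ'.partial e) h) (hI hψ' (h.partial e)) (hI hψ' h)
    (fun x _ => hψ'.1.differentiable (by simp) x) (fun x _ => h.1.differentiable (by simp) x)
  simp only [hd] at this
  rw [eq_neg_iff_add_eq_zero, add_comm, ← eq_neg_iff_add_eq_zero]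
  exact this

theorem ae_eq_of_integral_test_eq_zero {f : Space N → ℂ} (hf : LocallyIntegrableOn f (Omega N))
    (h : ∀ ψ : Space N → ℝ, IsTest ψ → ∫ x in Omega N, ((ψ x : ℝ) : ℂ) * f x = 0) :
    f =ᵐ[volume.restrict (Omega N)] 0 := by
  have := isOpen_Omega.ae_eq_zero_of_integral_contDiff_smul_eq_zero hf (fun g h1 h2 h3 => by
    have := h g ⟨h1, h2, h3⟩
    rw [setIntegral_Omega_eq] at this
    · simpa only [Complex.real_smul] using this
    · intro x hx
      have : g x = 0 := image_eq_zero_of_notMem_tsupport fun h' => hx (h3 h')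
      simp [this])
  exact (ae_restrict_iff' isOpen_Omega.measurableSet).2 this

theorem LocallyIntegrableOn.coord {v : Space N → EuclideanSpace ℂ (Fin 2 ⊕ Fin (N - 2))}
    {S : Set (Space N)} (hv : LocallyIntegrableOn v S) (j : Fin 2 ⊕ Fin (N - 2)) :
    LocallyIntegrableOn (fun x => v x j) S := fun x hx => by
  obtain ⟨t, ht, h⟩ := hv x hx
  exact ⟨t, ht, (EuclideanSpace.proj (𝕜 := ℂ) j).integrable_comp h⟩

/-- By the fundamental lemma of the calculus of variations. Hence `covGrad`, which rests on a choice
of weak gradient, is determined almost everywhere. -/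
theorem IsWeakGrad.ae_eq {u : Space N → ℂ}
    {v w : Space N → EuclideanSpace ℂ (Fin 2 ⊕ Fin (N - 2))} (hv : IsWeakGrad u v)
    (hw : IsWeakGrad u w) : v =ᵐ[volume.restrict (Omega N)] w := by
  have key : ∀ j, (fun x => v x j - w x j) =ᵐ[volume.restrict (Omega N)] 0 := by
    intro j
    have hv' := LocallyIntegrableOn.coord hv.2.1 j
    have hw' := LocallyIntegrableOn.coord hw.2.1 j
    refine ae_eq_of_integral_test_eq_zero (hv'.sub hw') fun ψ hψ => ?_
    have h1 := hψ.toComplex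
    have hi : ∀ {f : Space N → ℂ}, LocallyIntegrableOn f (Omega N) →
        Integrable (fun x => ((ψ x : ℝ) : ℂ) * f x) (volume.restrict (Omega N)) := fun hf =>
      (integrable_mul_of_tsupport_subset h1.1.continuous h1.2.1 h1.2.2 hf).restrict
    simp only [mul_sub]
    rw [integral_sub (hi hv') (hi hw'), sub_eq_zero]
    have := (hv.2.2 ψ hψ j).symm.trans (hw.2.2 ψ hψ j)
    exact neg_injective this
  filter_upwards [ae_all_iff.2 key] with x hx
  ext j
  exact sub_eq_zero.1 (hx j)

theorem isWeakGrad_weakGrad {u : Space N → ℂ} (h : ∃ v, IsWeakGrad u v) :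
    IsWeakGrad u (weakGrad u) := by
  rw [weakGrad, dif_pos h]
  exact h.choose_spec

/-! ### Stability of weak gradients under limits -/

theorem tendsto_integral_mul_of_tendsto_eLpNorm {μ : Measure (Space N)}
    [IsFiniteMeasureOnCompacts μ] {p : ENNReal} (hp : 1 ≤ p)
    {b : Space N → ℂ} (hb : Continuous b) (hc : HasCompactSupport b)
    {f : ℕ → Space N → ℂ} {g : Space N → ℂ}
    (hf : ∀ n, MemLp (f n) p μ)
    (hg : MemLp g p μ)
    (h : Tendsto (fun n => eLpNorm (fun x => f n x - g x) p μ)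
      atTop (𝓝 0)) :
    Tendsto (fun n => ∫ x, b x * f n x ∂μ) atTop (𝓝 (∫ x, b x * g x ∂μ)) := by
  obtain ⟨M, hM⟩ := hb.bounded_above_of_compact_support hc
  obtain ⟨C, hC, hCb⟩ := exists_eLpNorm_le_of_bound (μ := μ) hp
    one_ne_zero (isClosed_tsupport b).measurableSet
    hc.isCompact.measure_lt_top.ne M
  have hbd : ∀ {f : Space N → ℂ}, AEStronglyMeasurable f μ →
      eLpNorm (fun x => b x * f x) 1 μ ≤
        C * eLpNorm f p μ := fun {f} hf => by
    refine hCb _ f hf (fun x _ => ?_) (fun x hx => ?_)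
    · rw [norm_mul]
      exact mul_le_mul_of_nonneg_right (hM x) (norm_nonneg _)
    · rw [image_eq_zero_of_notMem_tsupport hx, zero_mul]
  have hbm := hb.aestronglyMeasurable (μ := μ)
  have hint : ∀ {f : Space N → ℂ}, MemLp f p μ →
      Integrable (fun x => b x * f x) μ := fun hf =>
    memLp_one_iff_integrable.1 ⟨hbm.mul hf.1,
      (hbd hf.1).trans_lt (ENNReal.mul_lt_top hC.lt_top hf.2)⟩
  refine tendsto_integral_of_L1' (fun x => b x * g x) (hint hg).1
    (F := fun n x => b x * f n x) (Eventually.of_forall fun n => hint (hf n)) ?_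
  have h1 := ENNReal.Tendsto.const_mul (a := C) h (Or.inr hC)
  rw [mul_zero] at h1
  refine tendsto_of_tendsto_of_tendsto_of_le_of_le tendsto_const_nhds h1 (fun _ => zero_le) ?_
  intro n
  have h2 : ((fun x => b x * f n x) - fun x => b x * g x) = fun x => b x * (f n x - g x) := by
    ext x
    simp [mul_sub]
  beta_reduce
  rw [h2]
  exact hbd (f := fun x => f n x - g x) ((hf n).1.sub hg.1)

theorem locallyIntegrableOn_of_memLp {E : Type*} [NormedAddCommGroup E] {f : Space N → E}
    {p : ENNReal} (hp : 1 ≤ p) (hf : MemLp f p (volume.restrict (Omega N))) :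
    LocallyIntegrableOn f (Omega N) :=
  locallyIntegrableOn_of_locallyIntegrable_restrict (hf.locallyIntegrable hp)

/-- Both sides of the defining identity pass to the limit. Two exponents are needed because
functions converge in `L^{2*}` and gradients in `L²`. -/
theorem isWeakGrad_of_tendsto {p q : ENNReal} (hp : 1 ≤ p) (hq : 1 ≤ q)
    {f : ℕ → Space N → ℂ} {g : Space N → ℂ}
    {v : ℕ → Space N → EuclideanSpace ℂ (Fin 2 ⊕ Fin (N - 2))}
    {w : Space N → EuclideanSpace ℂ (Fin 2 ⊕ Fin (N - 2))}
    (hfv : ∀ n, IsWeakGrad (f n) (v n))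
    (hf : ∀ n, MemLp (f n) p (volume.restrict (Omega N)))
    (hg : MemLp g p (volume.restrict (Omega N)))
    (hv : ∀ n, MemLp (v n) q (volume.restrict (Omega N)))
    (hw : MemLp w q (volume.restrict (Omega N)))
    (h1 : Tendsto (fun n => eLpNorm (fun x => f n x - g x) p (volume.restrict (Omega N)))
      atTop (𝓝 0))
    (h2 : Tendsto (fun n => eLpNorm (fun x => v n x - w x) q (volume.restrict (Omega N)))
      atTop (𝓝 0)) : IsWeakGrad g w := by
  refine ⟨locallyIntegrableOn_of_memLp hp hg, locallyIntegrableOn_of_memLp hq hw, ?_⟩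
  intro ψ hψ j
  have ha := (hψ.partial (EuclideanSpace.single j 1)).toComplex
  have hb := hψ.toComplex
  have l1 := tendsto_integral_mul_of_tendsto_eLpNorm hp ha.1.continuous ha.2.1 hf hg h1
  have hc : ∀ {v : Space N → EuclideanSpace ℂ (Fin 2 ⊕ Fin (N - 2))},
      MemLp v q (volume.restrict (Omega N)) → MemLp (fun x => v x j) q (volume.restrict (Omega N)) :=
    fun hv => (EuclideanSpace.proj (𝕜 := ℂ) j).comp_memLp' hv
  have l2 := tendsto_integral_mul_of_tendsto_eLpNorm hq hb.1.continuous hb.2.1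
    (fun n => hc (hv n)) (hc hw) (by
      refine tendsto_of_tendsto_of_tendsto_of_le_of_le tendsto_const_nhds h2 (fun _ => zero_le) ?_
      intro n
      refine eLpNorm_mono fun x => ?_
      exact PiLp.norm_apply_le (v n x - w x) j)
  exact tendsto_nhds_unique l1 (l2.neg.congr fun n => ((hfv n).2.2 ψ hψ j).symm)

theorem two_le_critExp (hN : 3 ≤ N) : 2 ≤ ENNReal.ofReal (critExp N) := by
  have h3 : (3 : ℝ) ≤ N := by exact_mod_cast hN
  have : (2 : ℝ) ≤ critExp N := by
    rw [critExp, le_div_iff₀ (by linarith)]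
    linarith
  simpa using ENNReal.ofReal_le_ofReal this

theorem one_le_critExp (hN : 3 ≤ N) : 1 ≤ ENNReal.ofReal (critExp N) :=
  one_le_two.trans (two_le_critExp hN)

theorem critExp_ne_zero (hN : 3 ≤ N) : ENNReal.ofReal (critExp N) ≠ 0 :=
  (zero_lt_one.trans_le (one_le_critExp hN)).ne'

/-! ### The regularised modulus `√(|w|² + ε²) - ε` and its gradient -/

/-- A smooth approximation of `|w|` that vanishes at `0`. -/
noncomputable def regMod (ε : ℝ) (w : ℂ) : ℝ := √(‖w‖ ^ 2 + ε ^ 2) - ε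

/-- `Re (conj w * p) / √(|w|² + ε²)`, the gradient of `regMod ε φ` where `φ` has the value `w` and
the gradient `p`. -/
noncomputable def regGrad (ε : ℝ) (w : ℂ) (p : EuclideanSpace ℂ (Fin 2 ⊕ Fin (N - 2))) :
    EuclideanSpace ℂ (Fin 2 ⊕ Fin (N - 2)) :=
  WithLp.toLp 2 fun j => (((inner ℝ w (p j)) / √(‖w‖ ^ 2 + ε ^ 2) : ℝ) : ℂ)

theorem regMod_zero_right {ε : ℝ} (hε : 0 ≤ ε) : regMod ε 0 = 0 := by
  simp [regMod, Real.sqrt_sq hε]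

theorem regMod_zero_left (w : ℂ) : regMod 0 w = ‖w‖ := by
  simp [regMod]

theorem continuous_regMod : Continuous fun q : ℝ × ℂ => regMod q.1 q.2 := by
  unfold regMod
  fun_prop

/-- Since `√(|w|² + ε²)` is the modulus of `|w| + iε`, the reverse triangle inequality applies
twice. -/
theorem abs_regMod_sub_le (ε : ℝ) (a b : ℂ) : |regMod ε a - regMod ε b| ≤ ‖a - b‖ := by
  have h : ∀ w : ℂ, regMod ε w = ‖((‖w‖ : ℝ) : ℂ) + (ε : ℂ) * Complex.I‖ - ε := fun w => by
    rw [Complex.norm_add_mul_I, regMod]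
  rw [h, h, sub_sub_sub_cancel_right]
  refine (abs_norm_sub_norm_le _ _).trans ?_
  rw [add_sub_add_right_eq_sub, ← Complex.ofReal_sub, Complex.norm_real]
  exact abs_norm_sub_norm_le a b

theorem abs_regMod_le {ε : ℝ} (hε : 0 ≤ ε) (w : ℂ) : |regMod ε w| ≤ ‖w‖ := by
  simpa [regMod_zero_right hε] using abs_regMod_sub_le ε w 0

theorem norm_regGrad_le (ε : ℝ) (w : ℂ) (p : EuclideanSpace ℂ (Fin 2 ⊕ Fin (N - 2))) :
    ‖regGrad ε w p‖ ≤ ‖p‖ := by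
  rw [EuclideanSpace.norm_eq, EuclideanSpace.norm_eq]
  refine Real.sqrt_le_sqrt (Finset.sum_le_sum fun j _ => ?_)
  refine pow_le_pow_left₀ (norm_nonneg _) ?_ 2
  simp only [regGrad, Complex.norm_real, Real.norm_eq_abs, abs_div, abs_of_nonneg (Real.sqrt_nonneg _)]
  refine div_le_of_le_mul₀ (Real.sqrt_nonneg _) (norm_nonneg _) ?_
  refine (abs_real_inner_le_norm w (p j)).trans ?_
  rw [mul_comm]
  refine mul_le_mul_of_nonneg_left ?_ (norm_nonneg _)
  exact Real.le_sqrt_of_sq_le (by linarith [sq_nonneg ε])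

theorem regGrad_add (ε : ℝ) (w : ℂ) (p q : EuclideanSpace ℂ (Fin 2 ⊕ Fin (N - 2))) :
    regGrad ε w (p + q) = regGrad ε w p + regGrad ε w q := by
  ext j
  simp [regGrad, inner_add_right, add_div]

theorem regGrad_sub (ε : ℝ) (w : ℂ) (p q : EuclideanSpace ℂ (Fin 2 ⊕ Fin (N - 2))) :
    regGrad ε w (p - q) = regGrad ε w p - regGrad ε w q := by
  ext j
  simp [regGrad, inner_sub_right, sub_div]

/-- Each coordinate of the magnetic term is `i` times a real multiple of `u x`, so its real inner
product with `u x` is zero. This lets the covariant gradient stand in for the gradient inside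
`regGrad`. -/
theorem regGrad_magneticTerm (ε s : ℝ) (u : Space N → ℂ) (x : Space N) :
    regGrad ε (u x) (magneticTerm s u x) = 0 := by
  ext j
  have : inner ℝ (u x) (magneticTerm s u x j) = 0 := by
    simp only [magneticTerm, Complex.inner, Complex.mul_re, Complex.mul_im, Complex.conj_re,
      Complex.conj_im, Complex.ofReal_re, Complex.ofReal_im, Complex.I_re, Complex.I_im]
    ring
  simp only [regGrad, this, zero_div, Complex.ofReal_zero, PiLp.zero_apply]

theorem regGrad_zero_left (ε : ℝ) (p : EuclideanSpace ℂ (Fin 2 ⊕ Fin (N - 2))) :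
    regGrad ε 0 p = 0 := by
  ext j
  simp [regGrad]

theorem tendsto_regGrad {ι : Type*} {l : Filter ι} {ε : ι → ℝ} {w : ι → ℂ} {ε₀ : ℝ} {w₀ : ℂ}
    (hε : Tendsto ε l (𝓝 ε₀)) (hw : Tendsto w l (𝓝 w₀)) (h : ‖w₀‖ ^ 2 + ε₀ ^ 2 ≠ 0)
    (p : EuclideanSpace ℂ (Fin 2 ⊕ Fin (N - 2))) :
    Tendsto (fun i => regGrad (ε i) (w i) p) l (𝓝 (regGrad ε₀ w₀ p)) := by
  refine ((PiLp.continuous_toLp 2 _).tendsto _).comp (tendsto_pi_nhds.2 fun j => ?_)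
  refine (Complex.continuous_ofReal.tendsto _).comp ?_
  refine (hw.inner tendsto_const_nhds).div ?_ ?_
  · exact (Real.continuous_sqrt.tendsto _).comp ((hw.norm.pow 2).add (hε.pow 2))
  · exact (Real.sqrt_pos.2 (lt_of_le_of_ne (by positivity) h.symm)).ne'

theorem aestronglyMeasurable_regGrad {ε : ℝ} {u : Space N → ℂ}
    {D : Space N → EuclideanSpace ℂ (Fin 2 ⊕ Fin (N - 2))} {μ : Measure (Space N)}
    (hu : AEStronglyMeasurable u μ) (hD : AEStronglyMeasurable D μ) :
    AEStronglyMeasurable (fun x => regGrad ε (u x) (D x)) μ := by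
  refine AEMeasurable.aestronglyMeasurable ?_
  refine (WithLp.measurable_toLp 2 _).comp_aemeasurable (aemeasurable_pi_lambda _ fun j => ?_)
  have h1 : AEStronglyMeasurable (fun x => D x j) μ :=
    (EuclideanSpace.proj (𝕜 := ℂ) j).continuous.comp_aestronglyMeasurable hD
  have h2 : AEMeasurable (fun x => inner ℝ (u x) (D x j)) μ := (hu.inner h1).aemeasurable
  have h3 : AEMeasurable (fun x => √(‖u x‖ ^ 2 + ε ^ 2)) μ :=
    ((hu.norm.aemeasurable.pow_const 2).add_const _).sqrt
  exact Complex.measurable_ofReal.comp_aemeasurable (h2.div h3)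

theorem IsTest.regMod {φ : Space N → ℂ} (h : IsTest φ) {ε : ℝ} (hε : 0 < ε) :
    IsTest (fun x => regMod ε (φ x)) := by
  have h0 := regMod_zero_right hε.le
  refine ⟨?_, h.2.1.comp_left h0, (tsupport_comp_subset h0 φ).trans h.2.2⟩
  exact (((h.1.norm_sq ℝ).add contDiff_const).sqrt fun x => by positivity).sub contDiff_const

theorem grad_toComplex {ψ : Space N → ℝ} {L : Space N →L[ℝ] ℝ} {x : Space N}
    (h : HasFDerivAt ψ L x) :
    grad (toComplex ψ) x = WithLp.toLp 2 fun j => ((L (EuclideanSpace.single j 1) : ℝ) : ℂ) := by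
  have h3 : fderiv ℝ (toComplex ψ) x = Complex.ofRealCLM.comp L :=
    ((Complex.ofRealCLM.hasFDerivAt (x := ψ x)).comp x h).fderiv
  ext j
  simp [grad, h3]

theorem grad_regMod {φ : Space N → ℂ} (h : IsTest φ) {ε : ℝ} (hε : 0 < ε) (x : Space N) :
    grad (toComplex fun x => regMod ε (φ x)) x = regGrad ε (φ x) (grad φ x) := by
  have h1 : HasFDerivAt φ (fderiv ℝ φ x) x := (h.1.differentiable (by simp) x).hasFDerivAt
  have h2 := ((h1.norm_sq.add_const (ε ^ 2)).sqrt (by positivity)).sub_const ε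
  have h3 : HasFDerivAt (fun x => regMod ε (φ x)) _ x := h2
  rw [grad_toComplex h3]
  ext j
  simp only [regGrad, grad]
  congr 1
  simp
  field_simp

theorem regGrad_testCovGrad (ε s : ℝ) (φ : Space N → ℂ) (x : Space N) :
    regGrad ε (φ x) (testCovGrad s φ x) = regGrad ε (φ x) (grad φ x) := by
  rw [testCovGrad, regGrad_add, regGrad_magneticTerm, add_zero]

theorem testCovGrad_zero (φ : Space N → ℂ) : testCovGrad 0 φ = grad φ := by
  ext x j
  simp [testCovGrad, magneticTerm]

/-! ### Approximation by real test functions -/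

/-- `(w, V)` is a limit of `(ψ, ∇ψ + i s 𝔸 ψ)`, `ψ ∈ C_c^∞(Ω, ℝ)`, in `L^{2*} × L²`. -/
def IsRealLimit (s : ℝ) (w : Space N → ℂ)
    (V : Space N → EuclideanSpace ℂ (Fin 2 ⊕ Fin (N - 2))) : Prop :=
  ∀ δ : ENNReal, δ ≠ 0 → ∃ ψ : Space N → ℝ, IsTest ψ ∧
    eLpNorm (fun x => toComplex ψ x - w x) (ENNReal.ofReal (critExp N))
      (volume.restrict (Omega N)) ≤ δ ∧
    eLpNorm (fun x => testCovGrad s (toComplex ψ) x - V x) 2 (volume.restrict (Omega N)) ≤ δ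

theorem IsTest.isRealLimit {ψ : Space N → ℝ} (h : IsTest ψ) (s : ℝ) :
    IsRealLimit s (AharonovBohm.toComplex ψ) (testCovGrad s (AharonovBohm.toComplex ψ)) :=
  fun δ _ => ⟨ψ, h, by simp, by simp⟩

/-- The support is compact and avoids `y = 0`, so `1/|y|` is bounded on it. -/
theorem exists_norm_magneticTerm_le {φ : Space N → ℂ} (h : IsTest φ) (s : ℝ) :
    ∃ M, ∀ x, ‖magneticTerm s φ x‖ ≤ M := by
  have hc : ContinuousOn (fun x => |s| * (‖φ x‖ / ‖yPart x‖)) (tsupport φ) := by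
    refine continuousOn_const.mul (h.1.continuous.norm.continuousOn.div
      continuous_yPart.norm.continuousOn fun x hx => ?_)
    exact norm_ne_zero_iff.2 (h.2.2 hx)
  obtain ⟨M, hM⟩ := h.2.1.isCompact.exists_bound_of_continuousOn hc
  refine ⟨max M 0, fun x => ?_⟩
  rw [norm_magneticTerm]
  by_cases hx : x ∈ tsupport φ
  · exact (le_abs_self _).trans ((hM x hx).trans (le_max_left _ _))
  · simp [image_eq_zero_of_notMem_tsupport hx]

theorem memLp_magneticTerm {φ : Space N → ℂ} (h : IsTest φ) (s : ℝ) (p : ENNReal)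
    (μ : Measure (Space N)) [IsFiniteMeasureOnCompacts μ] : MemLp (magneticTerm s φ) p μ := by
  obtain ⟨M, hM⟩ := exists_norm_magneticTerm_le h s
  refine memLp_of_bound_of_support (isClosed_tsupport φ).measurableSet
    h.2.1.isCompact.measure_lt_top.ne
    (aestronglyMeasurable_magneticTerm h.1.continuous.aestronglyMeasurable)
    (fun x _ => hM x) (fun x hx => ?_) p
  ext j
  simp [magneticTerm, image_eq_zero_of_notMem_tsupport hx]

theorem memLp_grad {φ : Space N → ℂ} (h : IsTest φ) (p : ENNReal)
    (μ : Measure (Space N)) [IsFiniteMeasureOnCompacts μ] : MemLp (grad φ) p μ :=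
  (continuous_grad h.1).memLp_of_hasCompactSupport
    (HasCompactSupport.intro h.2.1 fun _ hx => grad_eq_zero_of_notMem hx)

theorem memLp_testCovGrad {φ : Space N → ℂ} (h : IsTest φ) (s : ℝ) (p : ENNReal)
    (μ : Measure (Space N)) [IsFiniteMeasureOnCompacts μ] : MemLp (testCovGrad s φ) p μ :=
  (memLp_grad h p μ).add (memLp_magneticTerm h s p μ)

theorem eLpNorm_sub_le_of_le_half {α E : Type*} [MeasurableSpace α] {μ : Measure α}
    [NormedAddCommGroup E] {p : ENNReal} (hp : 1 ≤ p) {f g h : α → E}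
    (hf : AEStronglyMeasurable f μ) (hg : AEStronglyMeasurable g μ)
    (hh : AEStronglyMeasurable h μ) {δ : ENNReal}
    (h1 : eLpNorm (fun x => f x - g x) p μ ≤ δ / 2)
    (h2 : eLpNorm (fun x => g x - h x) p μ ≤ δ / 2) :
    eLpNorm (fun x => f x - h x) p μ ≤ δ := by
  have : (fun x => f x - h x) = (fun x => f x - g x) + fun x => g x - h x := by
    ext x
    simp
  rw [this]
  refine (eLpNorm_add_le (hf.sub hg) (hg.sub hh) hp).trans ?_
  exact (add_le_add h1 h2).trans_eq (ENNReal.add_halves δ)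

/-- A limit of limits is a limit. Iterated limits can thus be taken one at a time, without building
diagonal sequences. -/
theorem IsRealLimit.of_tendsto (hN : 3 ≤ N) {s : ℝ} {w : ℕ → Space N → ℂ} {w₀ : Space N → ℂ}
    {V : ℕ → Space N → EuclideanSpace ℂ (Fin 2 ⊕ Fin (N - 2))}
    {V₀ : Space N → EuclideanSpace ℂ (Fin 2 ⊕ Fin (N - 2))}
    (h : ∀ n, IsRealLimit s (w n) (V n))
    (hw : ∀ n, AEStronglyMeasurable (w n) (volume.restrict (Omega N)))
    (hV : ∀ n, AEStronglyMeasurable (V n) (volume.restrict (Omega N)))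
    (hw₀ : AEStronglyMeasurable w₀ (volume.restrict (Omega N)))
    (hV₀ : AEStronglyMeasurable V₀ (volume.restrict (Omega N)))
    (h1 : Tendsto (fun n => eLpNorm (fun x => w n x - w₀ x) (ENNReal.ofReal (critExp N))
      (volume.restrict (Omega N))) atTop (𝓝 0))
    (h2 : Tendsto (fun n => eLpNorm (fun x => V n x - V₀ x) 2
      (volume.restrict (Omega N))) atTop (𝓝 0)) : IsRealLimit s w₀ V₀ := by
  intro δ hδ
  have hδ2 : 0 < δ / 2 := ENNReal.half_pos hδ
  obtain ⟨n, hn1, hn2⟩ :=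
    ((h1.eventually (ge_mem_nhds hδ2)).and (h2.eventually (ge_mem_nhds hδ2))).exists
  obtain ⟨ψ, hψ, hψ1, hψ2⟩ := h n (δ / 2) hδ2.ne'
  exact ⟨ψ, hψ,
    eLpNorm_sub_le_of_le_half (one_le_critExp hN)
      hψ.toComplex.1.continuous.aestronglyMeasurable (hw n) hw₀ hψ1 hn1,
    eLpNorm_sub_le_of_le_half one_le_two
      (memLp_testCovGrad hψ.toComplex s 2 _).1 (hV n) hV₀ hψ2 hn2⟩

theorem IsRealLimit.exists_seq {s : ℝ} {w : Space N → ℂ}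
    {V : Space N → EuclideanSpace ℂ (Fin 2 ⊕ Fin (N - 2))} (h : IsRealLimit s w V) :
    ∃ ψ : ℕ → Space N → ℝ, (∀ n, IsTest (ψ n)) ∧
      Tendsto (fun n => eLpNorm (fun x => toComplex (ψ n) x - w x) (ENNReal.ofReal (critExp N))
        (volume.restrict (Omega N))) atTop (𝓝 0) ∧
      Tendsto (fun n => eLpNorm (fun x => testCovGrad s (toComplex (ψ n)) x - V x) 2
        (volume.restrict (Omega N))) atTop (𝓝 0) := by
  -- At `n = 0` the tolerance is `⊤`, which is harmless.
  choose ψ h1 h2 h3 using fun n : ℕ => h ((n : ENNReal)⁻¹) (by simp)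
  have h0 := ENNReal.tendsto_inv_nat_nhds_zero
  exact ⟨ψ, h1,
    tendsto_of_tendsto_of_tendsto_of_le_of_le tendsto_const_nhds h0 (fun _ => zero_le) h2,
    tendsto_of_tendsto_of_tendsto_of_le_of_le tendsto_const_nhds h0 (fun _ => zero_le) h3⟩

/-- The potential disappears: `regMod ε (φ n)` has gradient `regGrad ε (φ n) (testCovGrad s (φ n))`.
Its distance to `regGrad ε u D` splits into `regGrad ε (φ n)` applied to `testCovGrad s (φ n) - D`,
controlled by contraction, and the change of base point from `φ n` to `u` at fixed `D`, controlled
by dominated convergence with majorant `2|D|`. -/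
theorem isRealLimit_regMod (hN : 3 ≤ N) {s : ℝ} {u : Space N → ℂ}
    {D : Space N → EuclideanSpace ℂ (Fin 2 ⊕ Fin (N - 2))}
    (hu : AEStronglyMeasurable u (volume.restrict (Omega N)))
    (hD : MemLp D 2 (volume.restrict (Omega N)))
    {φ : ℕ → Space N → ℂ} (hφ : ∀ n, IsTest (φ n))
    (h1 : Tendsto (fun n => eLpNorm (fun x => φ n x - u x) (ENNReal.ofReal (critExp N))
      (volume.restrict (Omega N))) atTop (𝓝 0))
    (h2 : Tendsto (fun n => eLpNorm (fun x => testCovGrad s (φ n) x - D x) 2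
      (volume.restrict (Omega N))) atTop (𝓝 0)) {ε : ℝ} (hε : 0 < ε) :
    IsRealLimit 0 (toComplex fun x => regMod ε (u x)) (fun x => regGrad ε (u x) (D x)) := by
  have hφm : ∀ n, AEStronglyMeasurable (φ n) (volume.restrict (Omega N)) := fun n =>
    (hφ n).1.continuous.aestronglyMeasurable
  -- Dominated convergence needs pointwise convergence, and a subsequence suffices to exhibit the
  -- limit.
  obtain ⟨ns, hns, hae⟩ := (tendstoInMeasure_of_tendsto_eLpNorm (critExp_ne_zero hN) hφm hu
    h1).exists_seq_tendsto_ae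
  have hreg : ∀ {v : Space N → ℂ}, AEStronglyMeasurable v (volume.restrict (Omega N)) →
      AEStronglyMeasurable (toComplex fun x => regMod ε (v x)) (volume.restrict (Omega N)) :=
    fun hv => (Complex.continuous_ofReal.comp (continuous_regMod.comp
      (Continuous.prodMk_right ε))).comp_aestronglyMeasurable hv
  refine IsRealLimit.of_tendsto hN (fun n => ((hφ (ns n)).regMod hε).isRealLimit 0)
    (fun n => hreg (hφm _)) (fun n => (memLp_testCovGrad ((hφ (ns n)).regMod hε).toComplex 0 2
      (volume.restrict (Omega N))).1)
    (hreg hu) (aestronglyMeasurable_regGrad hu hD.1) ?_ ?_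
  · refine tendsto_of_tendsto_of_tendsto_of_le_of_le tendsto_const_nhds
      (h1.comp hns.tendsto_atTop) (fun _ => zero_le) fun n => eLpNorm_mono fun x => ?_
    simp only [toComplex, ← Complex.ofReal_sub, Complex.norm_real]
    exact abs_regMod_sub_le ε _ _
  · have hA : Tendsto (fun n => eLpNorm
        (fun x => regGrad ε (φ (ns n) x) (D x) - regGrad ε (u x) (D x)) 2
        (volume.restrict (Omega N))) atTop (𝓝 0) := by
      refine tendsto_eLpNorm_zero_of_dominated two_ne_zero ENNReal.ofNat_ne_top
        (fun n => (aestronglyMeasurable_regGrad (hφm _) hD.1).sub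
          (aestronglyMeasurable_regGrad hu hD.1)) (hD.const_smul (2 : ℝ))
        (fun n => Eventually.of_forall fun x => ?_) ?_
      · refine (norm_sub_le _ _).trans ?_
        have h1 := norm_regGrad_le ε (φ (ns n) x) (D x)
        have h2 := norm_regGrad_le ε (u x) (D x)
        simp only [Pi.smul_apply, norm_smul, Real.norm_ofNat]
        linarith
      · filter_upwards [hae] with x hx
        have := tendsto_regGrad (tendsto_const_nhds (x := ε)) hx (by positivity) (D x)
        simpa using this.sub_const (regGrad ε (u x) (D x))
    have hB := (h2.comp hns.tendsto_atTop).add hA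
    rw [add_zero] at hB
    refine tendsto_of_tendsto_of_tendsto_of_le_of_le tendsto_const_nhds hB (fun _ => zero_le)
      fun n => ?_
    have hT := memLp_testCovGrad (hφ (ns n)) s 2 (volume.restrict (Omega N))
    have e : (fun x => testCovGrad 0 (toComplex fun x => regMod ε (φ (ns n) x)) x -
        regGrad ε (u x) (D x)) =
        (fun x => regGrad ε (φ (ns n) x) (testCovGrad s (φ (ns n)) x - D x)) +
          fun x => regGrad ε (φ (ns n) x) (D x) - regGrad ε (u x) (D x) := by
      ext1 x
      rw [testCovGrad_zero, grad_regMod (hφ _) hε, Pi.add_apply, regGrad_sub, regGrad_testCovGrad]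
      abel
    rw [e]
    refine (eLpNorm_add_le (aestronglyMeasurable_regGrad (hφm _) (hT.1.sub hD.1))
      ((aestronglyMeasurable_regGrad (hφm _) hD.1).sub
        (aestronglyMeasurable_regGrad hu hD.1)) one_le_two).trans ?_
    exact add_le_add_left (eLpNorm_mono fun x => norm_regGrad_le _ _ _) _

theorem isRealLimit_norm (hN : 3 ≤ N) {s : ℝ} {u : Space N → ℂ}
    {D : Space N → EuclideanSpace ℂ (Fin 2 ⊕ Fin (N - 2))}
    (hu : MemLp u (ENNReal.ofReal (critExp N)) (volume.restrict (Omega N)))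
    (hD : MemLp D 2 (volume.restrict (Omega N)))
    {φ : ℕ → Space N → ℂ} (hφ : ∀ n, IsTest (φ n))
    (h1 : Tendsto (fun n => eLpNorm (fun x => φ n x - u x) (ENNReal.ofReal (critExp N))
      (volume.restrict (Omega N))) atTop (𝓝 0))
    (h2 : Tendsto (fun n => eLpNorm (fun x => testCovGrad s (φ n) x - D x) 2
      (volume.restrict (Omega N))) atTop (𝓝 0)) :
    IsRealLimit 0 (toComplex fun x => ‖u x‖) (fun x => regGrad 0 (u x) (D x)) := by
  have hε : ∀ n : ℕ, (0 : ℝ) < 1 / ((n : ℝ) + 1) := fun n => Nat.one_div_pos_of_nat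
  have hε0 : Tendsto (fun n : ℕ => 1 / ((n : ℝ) + 1)) atTop (𝓝 0) :=
    tendsto_one_div_add_atTop_nhds_zero_nat
  have hreg : ∀ ε : ℝ,
      AEStronglyMeasurable (toComplex fun x => regMod ε (u x)) (volume.restrict (Omega N)) :=
    fun ε => (Complex.continuous_ofReal.comp (continuous_regMod.comp
      (Continuous.prodMk_right ε))).comp_aestronglyMeasurable hu.1
  have hnm : AEStronglyMeasurable (toComplex fun x => ‖u x‖) (volume.restrict (Omega N)) :=
    Complex.continuous_ofReal.comp_aestronglyMeasurable hu.1.norm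
  refine IsRealLimit.of_tendsto hN (fun n => isRealLimit_regMod hN hu.1 hD hφ h1 h2 (hε n))
    (fun n => hreg _) (fun n => aestronglyMeasurable_regGrad hu.1 hD.1) hnm
    (aestronglyMeasurable_regGrad hu.1 hD.1) ?_ ?_
  · refine tendsto_eLpNorm_zero_of_dominated (critExp_ne_zero hN) ENNReal.ofReal_ne_top
      (fun n => (hreg _).sub hnm) (hu.const_smul (2 : ℝ))
      (fun n => Eventually.of_forall fun x => ?_) (Eventually.of_forall fun x => ?_)
    · have h1 := abs_regMod_le (hε n).le (u x)
      refine (norm_sub_le _ _).trans ?_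
      simp only [toComplex, Complex.norm_real, Real.norm_eq_abs, abs_norm, Pi.smul_apply,
        norm_smul, abs_two]
      linarith
    · have h1 : Tendsto (fun n : ℕ => regMod (1 / ((n : ℝ) + 1)) (u x)) atTop
          (𝓝 (regMod 0 (u x))) :=
        ((continuous_regMod.comp (Continuous.prodMk_left (u x))).tendsto 0).comp hε0
      rw [regMod_zero_left] at h1
      have h2 := ((Complex.continuous_ofReal.tendsto _).comp h1).sub_const ((‖u x‖ : ℝ) : ℂ)
      simpa [toComplex] using h2
  · refine tendsto_eLpNorm_zero_of_dominated two_ne_zero ENNReal.ofNat_ne_top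
      (fun n => (aestronglyMeasurable_regGrad hu.1 hD.1).sub
        (aestronglyMeasurable_regGrad hu.1 hD.1)) (hD.const_smul (2 : ℝ))
      (fun n => Eventually.of_forall fun x => ?_) (Eventually.of_forall fun x => ?_)
    · refine (norm_sub_le _ _).trans ?_
      have h1 := norm_regGrad_le (1 / ((n : ℝ) + 1)) (u x) (D x)
      have h2 := norm_regGrad_le 0 (u x) (D x)
      simp only [Pi.smul_apply, norm_smul, Real.norm_ofNat]
      linarith
    -- At zeros of `u` the quotient defining `regGrad` is singular as `ε → 0`, but its numerator is
    -- already zero for every `ε`.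
    · rcases eq_or_ne (u x) 0 with h0 | h0
      · simp [h0, regGrad_zero_left]
      · have := tendsto_regGrad hε0 (tendsto_const_nhds (x := u x)) (by positivity) (D x)
        simpa using this.sub_const (regGrad 0 (u x) (D x))

/-! ### Rotations in the plane of `y` -/

theorem ext_yPart {x x' : Space N} (h : yPart x = yPart x')
    (h' : ∀ j, x (Sum.inr j) = x' (Sum.inr j)) : x = x' := by
  ext j
  rcases j with j | j
  · fin_cases j
    · exact congrArg Complex.re h
    · exact congrArg Complex.im h
  · exact h' j

theorem yPart_add (x x' : Space N) : yPart (x + x') = yPart x + yPart x' := by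
  apply Complex.ext <;> simp [yPart]

theorem yPart_smul (a : ℝ) (x : Space N) : yPart (a • x) = a * yPart x := by
  apply Complex.ext <;> simp [yPart]

theorem yPart_act (c : Circle) (h : OrthGroup (N - 2)) (x : Space N) :
    yPart (act c h x) = c * yPart x := by
  apply Complex.ext <;> simp [act, yPart]

theorem act_one_inr (c : Circle) (x : Space N) (j : Fin (N - 2)) :
    act c 1 x (Sum.inr j) = x (Sum.inr j) := by
  simp [act, zPart]

/-- The infinitesimal rotation `(y, z) ↦ (i y, 0)`. -/
noncomputable def spin : Space N →L[ℝ] Space N :=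
  LinearMap.toContinuousLinearMap
    { toFun := fun x => WithLp.toLp 2 (Sum.elim ![-x (Sum.inl 1), x (Sum.inl 0)] fun _ => 0)
      map_add' := fun x x' => by
        ext j
        rcases j with j | j
        · fin_cases j <;> simp [add_comm]
        · simp
      map_smul' := fun a x => by
        ext j
        rcases j with j | j
        · fin_cases j <;> simp
        · simp }

theorem spin_apply (x : Space N) : spin x =
    (-x (Sum.inl 1)) • EuclideanSpace.single (Sum.inl 0) (1 : ℝ) +
      x (Sum.inl 0) • EuclideanSpace.single (Sum.inl 1) (1 : ℝ) := by
  ext j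
  rcases j with j | j
  · fin_cases j <;> simp [spin]
  · simp [spin]

theorem yPart_spin (x : Space N) : yPart (spin x) = Complex.I * yPart x := by
  apply Complex.ext <;> simp [spin, yPart]

theorem spin_inr (x : Space N) (j : Fin (N - 2)) : spin x (Sum.inr j) = 0 := by
  simp [spin]

/-- With `J = spin`, this is `exp(tJ) = 1 + sin t J + (1 - cos t) J²`, valid because `J² = -1` on
the `y`-plane and `J = 0` on the `z`-space. Continuity and the `t`-derivative can be read off from
it. -/
theorem act_exp_eq (t : ℝ) (x : Space N) :
    act (Circle.exp t) 1 x = x + Real.sin t • spin x + (1 - Real.cos t) • spin (spin x) := by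
  refine ext_yPart ?_ fun j => ?_
  · rw [yPart_act, yPart_add, yPart_add, yPart_smul, yPart_smul, yPart_spin, yPart_spin,
      yPart_spin, Circle.coe_exp, Complex.exp_mul_I]
    push_cast
    linear_combination (1 - Complex.cos t) * (-yPart x) * Complex.I_mul_I
  · simp [act_one_inr, spin_inr]

theorem hasDerivAt_act_exp (t : ℝ) (x : Space N) :
    HasDerivAt (fun t => act (Circle.exp t) 1 x) (spin (act (Circle.exp t) 1 x)) t := by
  simp only [act_exp_eq]
  have h1 := (((Real.hasDerivAt_sin t).smul_const (spin x)).const_add x).add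
    (((Real.hasDerivAt_cos t).const_sub 1).smul_const (spin (spin x)))
  refine h1.congr_deriv ?_
  refine ext_yPart ?_ fun j => ?_
  · simp only [map_add, map_smul, yPart_add, yPart_smul, yPart_spin]
    push_cast
    linear_combination (Complex.cos t - 1) * Complex.I * yPart x * Complex.I_mul_I
  · simp [spin_inr]

theorem continuous_act_exp : Continuous fun q : ℝ × Space N => act (Circle.exp q.1) 1 q.2 := by
  simp only [act_exp_eq]
  fun_prop

theorem act_mem_Omega {c : Circle} {h : OrthGroup (N - 2)} {x : Space N} :
    act c h x ∈ Omega N ↔ x ∈ Omega N := by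
  simp [Omega, yPart_act]

theorem norm_act_one (c : Circle) (x : Space N) : ‖act c 1 x‖ = ‖x‖ := by
  rw [EuclideanSpace.norm_eq, EuclideanSpace.norm_eq]
  congr 1
  simp only [Fintype.sum_sum_type, Fin.sum_univ_two, act_one_inr, Real.norm_eq_abs, sq_abs]
  rw [← norm_yPart_sq, ← norm_yPart_sq, yPart_act, norm_mul,
    Circle.norm_coe, one_mul]

theorem act_act_one (c d : Circle) (x : Space N) : act c 1 (act d 1 x) = act (c * d) 1 x := by
  refine ext_yPart ?_ fun j => ?_
  · simp [yPart_act, mul_assoc]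
  · simp [act_one_inr]

/-- The rotation `(y, z) ↦ (c y, z)` as a linear isometry. -/
noncomputable def rotation (c : Circle) : Space N ≃ₗᵢ[ℝ] Space N where
  toFun := act c 1
  invFun := act c⁻¹ 1
  left_inv x := by
    rw [act_act_one]
    exact ext_yPart (by simp [yPart_act]) fun j => by simp [act_one_inr]
  right_inv x := by
    rw [act_act_one]
    exact ext_yPart (by simp [yPart_act]) fun j => by simp [act_one_inr]
  map_add' x x' := ext_yPart (by simp [yPart_act, yPart_add, mul_add]) fun j => by
    simp [act_one_inr]
  map_smul' a x := ext_yPart (by simp [yPart_act, yPart_smul]; ring) fun j => by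
    simp [act_one_inr]
  norm_map' x := norm_act_one c x

/-! ### Integrals against rotationally invariant functions -/

theorem measurePreserving_act_one (c : Circle) :
    MeasurePreserving (act c 1) (volume.restrict (Omega N)) (volume.restrict (Omega N)) := by
  have h := (rotation (N := N) c).measurePreserving.restrict_preimage
    (isOpen_Omega (N := N)).measurableSet
  have e : (rotation (N := N) c) ⁻¹' Omega N = Omega N := Set.ext fun x => act_mem_Omega
  rw [e] at h
  exact h

theorem setIntegral_act_one_mul {u : Space N → ℂ} {c : Circle}
    (hu : ∀ᵐ x ∂(volume.restrict (Omega N)), u (act c 1 x) = u x) (f : Space N → ℂ) :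
    ∫ x in Omega N, f (act c 1 x) * u x = ∫ x in Omega N, f x * u x := by
  rw [← (measurePreserving_act_one c).integral_comp
    (rotation (N := N) c).toHomeomorph.measurableEmbedding (fun x => f x * u x)]
  refine integral_congr_ae ?_
  filter_upwards [hu] with x hx
  rw [hx]

theorem IsTest.angular {ψ : Space N → ℝ} (h : IsTest ψ) :
    IsTest (fun x => fderiv ℝ ψ x (spin x)) := by
  have hs : tsupport (fun x => fderiv ℝ ψ x (spin x)) ⊆ tsupport ψ := by
    refine closure_minimal (fun x hx => ?_) (isClosed_tsupport _)
    refine support_fderiv_subset ℝ fun h0 => hx ?_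
    simp [h0]
  refine ⟨(h.1.fderiv_right (m := ∞) (by simp)).clm_apply spin.contDiff, ?_, hs.trans h.2.2⟩
  exact h.2.1.of_isClosed_subset (isClosed_tsupport _) hs

/-- Invariance of `u` and of the measure makes the integral of `ψ(exp(tJ)x) u(x)` constant in `t`;
its derivative at `t = 0` is the claim. -/
theorem setIntegral_angular_mul_eq_zero {u : Space N → ℂ}
    (hloc : LocallyIntegrableOn u (Omega N))
    (hu : ∀ c : Circle, ∀ᵐ x ∂(volume.restrict (Omega N)), u (act c 1 x) = u x)
    {ψ : Space N → ℝ} (h : IsTest ψ) :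
    ∫ x in Omega N, ((fderiv ℝ ψ x (spin x) : ℝ) : ℂ) * u x = 0 := by
  set χ : Space N → ℝ := fun x => fderiv ℝ ψ x (spin x) with hχ
  have hχt : IsTest χ := h.angular
  -- The set swept out by the support of `χ` under rotations by angles in `[-1, 1]`. It is compact
  -- in `Ω`, so `u` is integrable on it, and it contains the supports of all the integrands
  -- differentiated in `t`.
  set K : Set (Space N) :=
    (fun q : ℝ × Space N => act (Circle.exp q.1) 1 q.2) '' (Set.Icc (-1) 1 ×ˢ tsupport χ) with hK
  have hKc : IsCompact K := (isCompact_Icc.prod hχt.2.1).image continuous_act_exp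
  have hKΩ : K ⊆ Omega N := by
    rintro _ ⟨⟨t, x⟩, ⟨-, hx⟩, rfl⟩
    exact act_mem_Omega.2 (hχt.2.2 hx)
  obtain ⟨M, hM⟩ := hχt.1.continuous.bounded_above_of_compact_support hχt.2.1
  have hcont : ∀ t : ℝ, Continuous fun x : Space N => act (Circle.exp t) 1 x := fun t =>
    continuous_act_exp.comp (Continuous.prodMk_right t)
  have hum := hloc.aestronglyMeasurable
  have hact0 : ∀ x : Space N, act (Circle.exp 0) 1 x = x := fun x => by
    rw [act_exp_eq]
    simp
  have hKi : IntegrableOn u K (volume.restrict (Omega N)) :=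
    (hloc.integrableOn_compact_subset hKΩ hKc).mono_measure Measure.restrict_le_self
  have key := hasDerivAt_integral_of_dominated_loc_of_deriv_le
    (μ := volume.restrict (Omega N)) (𝕜 := ℝ) (x₀ := (0 : ℝ)) (s := Set.Ioo (-1) 1)
    (F := fun t x => ((ψ (act (Circle.exp t) 1 x) : ℝ) : ℂ) * u x)
    (F' := fun t x => ((χ (act (Circle.exp t) 1 x) : ℝ) : ℂ) * u x)
    (bound := K.indicator fun x => M * ‖u x‖) (Ioo_mem_nhds (by norm_num) (by norm_num))
    (Eventually.of_forall fun t => (Complex.continuous_ofReal.comp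
      (h.1.continuous.comp (hcont t))).aestronglyMeasurable.mul hum)
    (by
      simp only [hact0]
      have h1 := h.toComplex
      exact (integrable_mul_of_tsupport_subset h1.1.continuous h1.2.1 h1.2.2 hloc).restrict)
    ((Complex.continuous_ofReal.comp
      (hχt.1.continuous.comp (hcont 0))).aestronglyMeasurable.mul hum)
    (Eventually.of_forall fun x t ht => by
      by_cases hx : x ∈ K
      · rw [Set.indicator_of_mem hx, norm_mul, Complex.norm_real]
        exact mul_le_mul_of_nonneg_right (hM _) (norm_nonneg _)
      · have : χ (act (Circle.exp t) 1 x) = 0 := by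
          by_contra hne
          refine hx ⟨(-t, act (Circle.exp t) 1 x), ⟨⟨?_, ?_⟩, subset_tsupport _ hne⟩, ?_⟩
          · linarith [ht.2]
          · linarith [ht.1]
          · simp only [act_act_one, ← Circle.exp_add, neg_add_cancel, hact0]
        rw [this, Set.indicator_of_notMem hx]
        simp)
    ((integrable_indicator_iff hKc.measurableSet).2 (hKi.norm.const_mul M))
    (Eventually.of_forall fun x t _ => by
      have h1 : HasFDerivAt ψ (fderiv ℝ ψ (act (Circle.exp t) 1 x)) (act (Circle.exp t) 1 x) :=
        (h.1.differentiable (by simp) _).hasFDerivAt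
      have h2 := h1.comp_hasDerivAt t (hasDerivAt_act_exp t x)
      exact (h2.ofReal_comp).mul_const (u x))
  have hconst : (fun t : ℝ => ∫ x in Omega N, ((ψ (act (Circle.exp t) 1 x) : ℝ) : ℂ) * u x) =
      fun _ => ∫ x in Omega N, ((ψ x : ℝ) : ℂ) * u x :=
    funext fun t => setIntegral_act_one_mul (hu _) fun x => ((ψ x : ℝ) : ℂ)
  have h0 := key.2.unique (hconst ▸ hasDerivAt_const (0 : ℝ) _)
  simpa only [hact0] using h0

theorem IsTest.coord_mul {ψ : Space N → ℝ} (h : IsTest ψ) (j : Fin 2 ⊕ Fin (N - 2)) :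
    IsTest (fun x => x j * ψ x) := by
  have hs : tsupport (fun x : Space N => x j * ψ x) ⊆ tsupport ψ :=
    tsupport_mul_subset_right
  refine ⟨(EuclideanSpace.proj (𝕜 := ℝ) j).contDiff.mul h.1, ?_, hs.trans h.2.2⟩
  exact h.2.1.of_isClosed_subset (isClosed_tsupport _) hs

theorem fderiv_coord_mul {ψ : Space N → ℝ} (h : IsTest ψ) {i j : Fin 2 ⊕ Fin (N - 2)}
    (hij : i ≠ j) (x : Space N) :
    fderiv ℝ (fun x : Space N => x j * ψ x) x (EuclideanSpace.single i 1) =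
      x j * fderiv ℝ ψ x (EuclideanSpace.single i 1) := by
  have h1 : HasFDerivAt ψ (fderiv ℝ ψ x) x := (h.1.differentiable (by simp) _).hasFDerivAt
  have h2 : HasFDerivAt (fun x : Space N => x j) (EuclideanSpace.proj (𝕜 := ℝ) j) x :=
    (EuclideanSpace.proj (𝕜 := ℝ) j : Space N →L[ℝ] ℝ).hasFDerivAt
  have h3 : HasFDerivAt (fun x : Space N => x j * ψ x) _ x := h2.mul h1
  rw [h3.fderiv]
  simp [hij.symm]

/-- The weak gradient of a function that is invariant under rotations of `y` is orthogonal to the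
direction of rotation. -/
theorem IsWeakGrad.angular_eq_zero {u : Space N → ℂ}
    {v : Space N → EuclideanSpace ℂ (Fin 2 ⊕ Fin (N - 2))} (h : IsWeakGrad u v)
    (hu : ∀ c : Circle, ∀ᵐ x ∂(volume.restrict (Omega N)), u (act c 1 x) = u x) :
    ∀ᵐ x ∂(volume.restrict (Omega N)),
      ((x (Sum.inl 1) : ℝ) : ℂ) * v x (Sum.inl 0) = ((x (Sum.inl 0) : ℝ) : ℂ) * v x (Sum.inl 1) := by
  have hcont : ∀ j : Fin 2 ⊕ Fin (N - 2), Continuous fun x : Space N => ((x j : ℝ) : ℂ) :=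
    fun j => by fun_prop
  have hv : ∀ i j : Fin 2 ⊕ Fin (N - 2),
      LocallyIntegrableOn (fun x : Space N => ((x j : ℝ) : ℂ) * v x i) (Omega N) := fun i j =>
    (LocallyIntegrableOn.coord h.2.1 i).continuousOn_mul (hcont j).continuousOn
      isOpen_Omega.isLocallyClosed
  have key := ae_eq_of_integral_test_eq_zero ((hv (Sum.inl 0) (Sum.inl 1)).sub
    (hv (Sum.inl 1) (Sum.inl 0))) fun ψ hψ => by
      have hang := setIntegral_angular_mul_eq_zero h.1 hu hψ
      have hi : ∀ {g : Space N → ℝ} {f : Space N → ℂ}, IsTest g → LocallyIntegrableOn f (Omega N) →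
          Integrable (fun x => ((g x : ℝ) : ℂ) * f x) (volume.restrict (Omega N)) := fun hg hf =>
        (integrable_mul_of_tsupport_subset hg.toComplex.1.continuous hg.toComplex.2.1
          hg.toComplex.2.2 hf).restrict
      -- The test functions are `y₂ψ` along `e₁` and `y₁ψ` along `e₂`. Each factor is constant in
      -- the direction of differentiation, so the difference of derivatives is exactly the angular
      -- derivative `y₁∂₂ψ - y₂∂₁ψ`.
      have e0 := h.2.2 _ (hψ.coord_mul (Sum.inl 1)) (Sum.inl 0)
      have e1 := h.2.2 _ (hψ.coord_mul (Sum.inl 0)) (Sum.inl 1)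
      have i0 := hi ((hψ.coord_mul (Sum.inl 1)).partial (EuclideanSpace.single (Sum.inl 0) 1)) h.1
      have i1 := hi ((hψ.coord_mul (Sum.inl 0)).partial (EuclideanSpace.single (Sum.inl 1) 1)) h.1
      have j0 := hi hψ (hv (Sum.inl 0) (Sum.inl 1))
      have j1 := hi hψ (hv (Sum.inl 1) (Sum.inl 0))
      have hsplit : ∀ x : Space N, ((fderiv ℝ ψ x (spin x) : ℝ) : ℂ) * u x =
          ((fderiv ℝ (fun x : Space N => x (Sum.inl 0) * ψ x) x
            (EuclideanSpace.single (Sum.inl 1) 1) : ℝ) : ℂ) * u x -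
          ((fderiv ℝ (fun x : Space N => x (Sum.inl 1) * ψ x) x
            (EuclideanSpace.single (Sum.inl 0) 1) : ℝ) : ℂ) * u x := fun x => by
        rw [fderiv_coord_mul hψ (by simp), fderiv_coord_mul hψ (by simp), spin_apply]
        simp only [map_add, map_smul, smul_eq_mul]
        push_cast
        ring
      simp only [hsplit] at hang
      rw [integral_sub i1 i0, e0, e1] at hang
      simp only [Pi.sub_apply, mul_sub]
      rw [integral_sub j0 j1]
      have c0 : ∫ x in Omega N, ((x (Sum.inl 1) * ψ x : ℝ) : ℂ) * v x (Sum.inl 0) =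
          ∫ x in Omega N, ((ψ x : ℝ) : ℂ) * (((x (Sum.inl 1) : ℝ) : ℂ) * v x (Sum.inl 0)) := by
        congr 1
        ext x
        push_cast
        ring
      have c1 : ∫ x in Omega N, ((x (Sum.inl 0) * ψ x : ℝ) : ℂ) * v x (Sum.inl 1) =
          ∫ x in Omega N, ((ψ x : ℝ) : ℂ) * (((x (Sum.inl 0) : ℝ) : ℂ) * v x (Sum.inl 1)) := by
        congr 1
        ext x
        push_cast
        ring
      rw [c0, c1] at hang
      linear_combination hang
  filter_upwards [key] with x hx
  exact sub_eq_zero.1 hx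

/-! ### Cut-off functions -/

theorem deriv_smoothTransition_eq_zero {t : ℝ} (ht : t < 0 ∨ 1 < t) :
    deriv Real.smoothTransition t = 0 := by
  rcases ht with ht | ht
  · have : Real.smoothTransition =ᶠ[𝓝 t] fun _ => 0 := by
      filter_upwards [gt_mem_nhds ht] with x hx using Real.smoothTransition.zero_of_nonpos hx.le
    rw [this.deriv_eq, deriv_const]
  · have : Real.smoothTransition =ᶠ[𝓝 t] fun _ => 1 := by
      filter_upwards [lt_mem_nhds ht] with x hx using Real.smoothTransition.one_of_one_le hx.le
    rw [this.deriv_eq, deriv_const]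

theorem exists_deriv_smoothTransition_le :
    ∃ B : ℝ, 0 ≤ B ∧ ∀ t, |deriv Real.smoothTransition t| ≤ B := by
  have hc : Continuous (deriv Real.smoothTransition) :=
    (Real.smoothTransition.contDiff (n := 1)).continuous_deriv le_rfl
  obtain ⟨B, hB⟩ := hc.bounded_above_of_compact_support
    (HasCompactSupport.intro isCompact_Icc (K := Set.Icc 0 1) fun t ht =>
      deriv_smoothTransition_eq_zero (by
        by_contra! h
        exact ht h))
  exact ⟨B, (norm_nonneg _).trans (hB 0), hB⟩

/-- The projection `x = (y, z) ↦ y` as a continuous linear map. -/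
noncomputable def yProj : Space N →L[ℝ] ℂ :=
  LinearMap.mkContinuous
    { toFun := yPart
      map_add' := yPart_add
      map_smul' := fun a x => by simpa using yPart_smul a x } 1
    fun x => by simpa using norm_yPart_le x

theorem norm_yProj_le : ‖(yProj : Space N →L[ℝ] ℂ)‖ ≤ 1 :=
  LinearMap.mkContinuous_norm_le _ zero_le_one _

/-- A smooth cut-off function that vanishes where `|y| ≤ 1/r` or `|x| ≥ √2 r`. -/
noncomputable def cutoff (r : ℝ) (x : Space N) : ℝ :=
  Real.smoothTransition (r ^ 2 * ‖yPart x‖ ^ 2 - 1) *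
    Real.smoothTransition (2 - (r ^ 2)⁻¹ * ‖x‖ ^ 2)

theorem contDiff_cutoff (r : ℝ) : ContDiff ℝ ∞ (cutoff r : Space N → ℝ) := by
  have hy : ContDiff ℝ ∞ (yPart : Space N → ℂ) := (yProj (N := N)).contDiff
  exact ((Real.smoothTransition.contDiff (n := ⊤)).comp
    ((contDiff_const.mul (hy.norm_sq ℝ)).sub contDiff_const)).mul
    ((Real.smoothTransition.contDiff (n := ⊤)).comp
      (contDiff_const.sub (contDiff_const.mul (contDiff_id.norm_sq ℝ))))

theorem cutoff_nonneg (r : ℝ) (x : Space N) : 0 ≤ cutoff r x :=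
  mul_nonneg (Real.smoothTransition.nonneg _) (Real.smoothTransition.nonneg _)

theorem cutoff_le_one (r : ℝ) (x : Space N) : cutoff r x ≤ 1 :=
  mul_le_one₀ (Real.smoothTransition.le_one _) (Real.smoothTransition.nonneg _)
    (Real.smoothTransition.le_one _)

theorem hasFDerivAt_cutoff (r : ℝ) (x : Space N) :
    HasFDerivAt (cutoff r)
      (Real.smoothTransition (r ^ 2 * ‖yPart x‖ ^ 2 - 1) •
          (deriv Real.smoothTransition (2 - (r ^ 2)⁻¹ * ‖x‖ ^ 2) •
            (-((r ^ 2)⁻¹ • ((2 : ℕ) • innerSL ℝ x : Space N →L[ℝ] ℝ)))) +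
        Real.smoothTransition (2 - (r ^ 2)⁻¹ * ‖x‖ ^ 2) •
          (deriv Real.smoothTransition (r ^ 2 * ‖yPart x‖ ^ 2 - 1) •
            (r ^ 2 • ((2 : ℕ) • (innerSL ℝ (yPart x)).comp yProj : Space N →L[ℝ] ℝ)))) x := by
  have hd : ∀ t, HasDerivAt Real.smoothTransition (deriv Real.smoothTransition t) t := fun t =>
    ((Real.smoothTransition.contDiff (n := 1)).differentiable (by simp) t).hasDerivAt
  have hy : HasFDerivAt (yPart : Space N → ℂ) yProj x := (yProj (N := N)).hasFDerivAt
  have h1 := (hd (r ^ 2 * ‖yPart x‖ ^ 2 - 1)).comp_hasFDerivAt x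
    ((hy.norm_sq.const_mul (r ^ 2)).sub_const 1)
  have h2 := (hd (2 - (r ^ 2)⁻¹ * ‖x‖ ^ 2)).comp_hasFDerivAt x
    (((hasFDerivAt_id x).norm_sq.const_mul (r ^ 2)⁻¹).const_sub 2)
  exact h1.mul h2

/-- The Riesz isometry in coordinates; it turns estimates on Fréchet derivatives into estimates on
`grad`. -/
theorem norm_gradVector (L : Space N →L[ℝ] ℝ) :
    ‖(WithLp.toLp 2 fun j => ((L (EuclideanSpace.single j 1) : ℝ) : ℂ) :
      EuclideanSpace ℂ (Fin 2 ⊕ Fin (N - 2)))‖ = ‖L‖ := by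
  rw [← (InnerProductSpace.toDual ℝ (Space N)).symm.norm_map L]
  set g := (InnerProductSpace.toDual ℝ (Space N)).symm L with hg
  have h : ∀ j, L (EuclideanSpace.single j 1) = g j := fun j => by
    rw [← InnerProductSpace.toDual_symm_apply (y := L), ← hg]
    simp [EuclideanSpace.inner_single_right]
  rw [EuclideanSpace.norm_eq, EuclideanSpace.norm_eq]
  simp [h]

/-- The strict inequalities make an argument of `Real.smoothTransition` negative, so that its
derivative vanishes along with its value. -/
theorem cutoff_grad_eq_zero {r : ℝ} (hr : 0 < r) {x : Space N}
    (hx : 2 * r < ‖x‖ ∨ r * ‖yPart x‖ < 1) :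
    cutoff r x = 0 ∧ grad (toComplex (cutoff r)) x = 0 := by
  have hT : ∀ t < 0, Real.smoothTransition t = 0 ∧ deriv Real.smoothTransition t = 0 :=
    fun t ht => ⟨Real.smoothTransition.zero_of_nonpos ht.le,
      deriv_smoothTransition_eq_zero (Or.inl ht)⟩
  rw [grad_toComplex (hasFDerivAt_cutoff r x), ← norm_eq_zero (a := WithLp.toLp _ _),
    norm_gradVector, norm_eq_zero, cutoff]
  rcases hx with hx | hx
  · have h1 : 2 - (r ^ 2)⁻¹ * ‖x‖ ^ 2 < 0 := by
      have h2 : (2 * r) ^ 2 < ‖x‖ ^ 2 := pow_lt_pow_left₀ hx (by positivity) two_ne_zero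
      have h3 : (2 : ℝ) < (r ^ 2)⁻¹ * ‖x‖ ^ 2 := by
        rw [inv_mul_eq_div, lt_div_iff₀ (by positivity)]
        nlinarith [sq_nonneg r]
      linarith
    simp [(hT _ h1).1, (hT _ h1).2]
  · have h1 : r ^ 2 * ‖yPart x‖ ^ 2 - 1 < 0 := by
      have : (r * ‖yPart x‖) ^ 2 < 1 := pow_lt_one₀ (by positivity) hx two_ne_zero
      rw [mul_pow] at this
      linarith
    simp [(hT _ h1).1, (hT _ h1).2]

theorem eventually_cutoff_eq_one {x : Space N} (hx : x ∈ Omega N) :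
    ∀ᶠ r in atTop, cutoff r x = 1 ∧ grad (toComplex (cutoff r)) x = 0 := by
  have hy : 0 < ‖yPart x‖ := norm_pos_iff.2 hx
  filter_upwards [eventually_gt_atTop (2 / ‖yPart x‖), eventually_gt_atTop (‖x‖ + 1)] with r h1 h2
  have hr : 0 < r := by linarith [norm_nonneg x]
  rw [div_lt_iff₀ hy] at h1
  have ha : 1 < r ^ 2 * ‖yPart x‖ ^ 2 - 1 := by nlinarith
  have hb : 1 < 2 - (r ^ 2)⁻¹ * ‖x‖ ^ 2 := by
    have : (r ^ 2)⁻¹ * ‖x‖ ^ 2 < 1 := by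
      rw [inv_mul_eq_div, div_lt_one (by positivity)]
      nlinarith [norm_nonneg x]
    linarith
  rw [grad_toComplex (hasFDerivAt_cutoff r x), ← norm_eq_zero (a := WithLp.toLp _ _),
    norm_gradVector, norm_eq_zero, cutoff, Real.smoothTransition.one_of_one_le ha.le,
    Real.smoothTransition.one_of_one_le hb.le, deriv_smoothTransition_eq_zero (Or.inr ha),
    deriv_smoothTransition_eq_zero (Or.inr hb)]
  simp

/-- The inner factor varies only where `r|y| ≤ √2`, so `2r²|y| ≤ 4/|y|` there. The outer one varies
only where `|x| ≤ √2 r`, so `2|x|/r² ≤ 4/|x| ≤ 4/|y|`. With `B` bounding the derivative of the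
transition function, the sum is `8B/|y|`, uniformly in `r`. -/
theorem exists_norm_grad_cutoff_le :
    ∃ C : ℝ, 0 ≤ C ∧ ∀ r > 0, ∀ x : Space N,
      ‖grad (toComplex (cutoff r)) x‖ ≤ C * ‖yPart x‖⁻¹ := by
  obtain ⟨B, hB0, hB⟩ := exists_deriv_smoothTransition_le
  refine ⟨8 * B, by positivity, fun r hr x => ?_⟩
  rcases eq_or_ne (yPart x) 0 with hy | hy
  · rw [(cutoff_grad_eq_zero hr (Or.inr (by simp [hy]))).2]
    simp [hy]
  have hy0 : 0 < ‖yPart x‖ := norm_pos_iff.2 hy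
  have hx0 : 0 < ‖x‖ := hy0.trans_le (norm_yPart_le x)
  rw [grad_toComplex (hasFDerivAt_cutoff r x), norm_gradVector]
  set a := r ^ 2 * ‖yPart x‖ ^ 2 - 1 with ha
  set b := 2 - (r ^ 2)⁻¹ * ‖x‖ ^ 2 with hb
  have hρ : ∀ t, ‖Real.smoothTransition t‖ ≤ 1 := fun t => by
    rw [Real.norm_of_nonneg (Real.smoothTransition.nonneg t)]
    exact Real.smoothTransition.le_one t
  have h1 : |deriv Real.smoothTransition b| * ((r ^ 2)⁻¹ * (2 * ‖x‖)) ≤ B * (4 * ‖yPart x‖⁻¹) := by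
    by_cases hb0 : b < 0
    · rw [deriv_smoothTransition_eq_zero (Or.inl hb0), abs_zero, zero_mul]
      positivity
    · refine mul_le_mul (hB b) ?_ (by positivity) hB0
      have h2 : (r ^ 2)⁻¹ * ‖x‖ ^ 2 ≤ 2 := by linarith
      calc (r ^ 2)⁻¹ * (2 * ‖x‖) = 2 * ((r ^ 2)⁻¹ * ‖x‖ ^ 2) * ‖x‖⁻¹ := by field_simp
        _ ≤ 2 * 2 * ‖yPart x‖⁻¹ := by
          gcongr
          exact norm_yPart_le x
        _ = 4 * ‖yPart x‖⁻¹ := by norm_num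
  have h2 : |deriv Real.smoothTransition a| * (r ^ 2 * (2 * ‖yPart x‖)) ≤
      B * (4 * ‖yPart x‖⁻¹) := by
    by_cases ha1 : 1 < a
    · rw [deriv_smoothTransition_eq_zero (Or.inr ha1), abs_zero, zero_mul]
      positivity
    · refine mul_le_mul (hB a) ?_ (by positivity) hB0
      have h3 : r ^ 2 * ‖yPart x‖ ^ 2 ≤ 2 := by linarith
      calc r ^ 2 * (2 * ‖yPart x‖) = 2 * (r ^ 2 * ‖yPart x‖ ^ 2) * ‖yPart x‖⁻¹ := by field_simp
        _ ≤ 2 * 2 * ‖yPart x‖⁻¹ := by gcongr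
        _ = 4 * ‖yPart x‖⁻¹ := by norm_num
  have n1 : ‖(2 : ℕ) • innerSL ℝ x‖ ≤ 2 * ‖x‖ := by
    rw [← Nat.cast_smul_eq_nsmul ℝ, norm_smul, innerSL_apply_norm]
    simp
  have n2 : ‖(2 : ℕ) • (innerSL ℝ (yPart x)).comp (yProj (N := N))‖ ≤ 2 * ‖yPart x‖ := by
    rw [← Nat.cast_smul_eq_nsmul ℝ, norm_smul]
    have : ‖(innerSL ℝ (yPart x)).comp (yProj (N := N))‖ ≤ ‖yPart x‖ := by
      refine (ContinuousLinearMap.opNorm_comp_le _ _).trans ?_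
      rw [innerSL_apply_norm]
      exact mul_le_of_le_one_right (norm_nonneg _) norm_yProj_le
    simpa using this
  refine (norm_add_le _ _).trans ?_
  simp only [norm_smul, norm_neg, Real.norm_eq_abs (deriv _ _)]
  have m1 : ‖(r ^ 2)⁻¹‖ = (r ^ 2)⁻¹ := Real.norm_of_nonneg (by positivity)
  have m2 : ‖r ^ 2‖ = r ^ 2 := Real.norm_of_nonneg (by positivity)
  rw [m1, m2]
  calc _ ≤ 1 * (|deriv Real.smoothTransition b| * ((r ^ 2)⁻¹ * (2 * ‖x‖))) +
        1 * (|deriv Real.smoothTransition a| * (r ^ 2 * (2 * ‖yPart x‖))) := by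
        gcongr
        · exact hρ a
        · exact hρ b
    _ ≤ 8 * B * ‖yPart x‖⁻¹ := by linarith

/-! ### Multiplication by cut-off functions -/

/-- Leibniz rule with the whole potential assigned to `θ`, so that `ψ` enters only through its
ordinary gradient. -/
theorem testCovGrad_mul {s : ℝ} {θ ψ : Space N → ℝ} {x : Space N}
    (hθ : DifferentiableAt ℝ θ x) (hψ : DifferentiableAt ℝ ψ x) :
    testCovGrad s (toComplex fun x => θ x * ψ x) x =
      ((θ x : ℝ) : ℂ) • testCovGrad 0 (toComplex ψ) x +
        ((ψ x : ℝ) : ℂ) • testCovGrad s (toComplex θ) x := by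
  have h : HasFDerivAt (fun x => θ x * ψ x) _ x := hθ.hasFDerivAt.mul hψ.hasFDerivAt
  rw [testCovGrad_zero, testCovGrad, testCovGrad, grad_toComplex h,
    grad_toComplex hθ.hasFDerivAt, grad_toComplex hψ.hasFDerivAt]
  ext j
  simp [magneticTerm, toComplex]
  ring

theorem IsTest.mul_left {ψ θ : Space N → ℝ} (h : IsTest ψ) (hθ : ContDiff ℝ ∞ θ) :
    IsTest (fun x => θ x * ψ x) := by
  have hs : tsupport (fun x : Space N => θ x * ψ x) ⊆ tsupport ψ := tsupport_mul_subset_right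
  exact ⟨hθ.mul h.1, h.2.1.of_isClosed_subset (isClosed_tsupport _) hs, hs.trans h.2.2⟩

/-- Passage from parameter `0` to parameter `s`: the potential falls on `θ`, whose covariant
gradient is bounded and lives in a ball. There `L^{2*}` convergence of the functions implies `L²`
convergence. -/
theorem IsRealLimit.mul_left (hN : 3 ≤ N) {s : ℝ} {w : Space N → ℂ}
    {V : Space N → EuclideanSpace ℂ (Fin 2 ⊕ Fin (N - 2))} (h : IsRealLimit 0 w V)
    (hw : AEStronglyMeasurable w (volume.restrict (Omega N)))
    (hV : AEStronglyMeasurable V (volume.restrict (Omega N)))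
    {θ : Space N → ℝ} (hθ : ContDiff ℝ ∞ θ) (hθ1 : ∀ x, |θ x| ≤ 1) {R M : ℝ}
    (hM : ∀ x, ‖testCovGrad s (toComplex θ) x‖ ≤ M)
    (hR : ∀ x, R < ‖x‖ → testCovGrad s (toComplex θ) x = 0) :
    IsRealLimit s (fun x => ((θ x : ℝ) : ℂ) * w x)
      (fun x => ((θ x : ℝ) : ℂ) • V x + w x • testCovGrad s (toComplex θ) x) := by
  obtain ⟨ψ, hψ, h1, h2⟩ := h.exists_seq
  have hθc : Continuous fun x => ((θ x : ℝ) : ℂ) := Complex.continuous_ofReal.comp hθ.continuous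
  have hθm : AEStronglyMeasurable (fun x => ((θ x : ℝ) : ℂ)) (volume.restrict (Omega N)) :=
    hθc.aestronglyMeasurable
  have hqm : AEStronglyMeasurable (testCovGrad s (toComplex θ)) (volume.restrict (Omega N)) :=
    (continuous_grad (Complex.ofRealCLM.contDiff.comp hθ)).aestronglyMeasurable.add
      (aestronglyMeasurable_magneticTerm hθm)
  have hψm : ∀ n, AEStronglyMeasurable (toComplex (ψ n)) (volume.restrict (Omega N)) := fun n =>
    (hψ n).toComplex.1.continuous.aestronglyMeasurable
  have hψV : ∀ n, AEStronglyMeasurable (testCovGrad 0 (toComplex (ψ n)))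
      (volume.restrict (Omega N)) := fun n => (memLp_testCovGrad (hψ n).toComplex 0 2 _).1
  refine IsRealLimit.of_tendsto hN (fun n => ((hψ n).mul_left hθ).isRealLimit s)
    (fun n => ((hψ n).mul_left hθ).toComplex.1.continuous.aestronglyMeasurable)
    (fun n => (memLp_testCovGrad ((hψ n).mul_left hθ).toComplex s 2
      (volume.restrict (Omega N))).1)
    (hθm.mul hw) ((hθm.smul hV).add (hw.smul hqm)) ?_ ?_
  · refine tendsto_of_tendsto_of_tendsto_of_le_of_le tendsto_const_nhds h1 (fun _ => zero_le)
      fun n => eLpNorm_mono fun x => ?_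
    have : toComplex (fun x => θ x * ψ n x) x - ((θ x : ℝ) : ℂ) * w x =
        ((θ x : ℝ) : ℂ) * (toComplex (ψ n) x - w x) := by
      simp only [toComplex]
      push_cast
      ring
    rw [this, norm_mul, Complex.norm_real]
    exact mul_le_of_le_one_left (norm_nonneg _) (hθ1 x)
  · obtain ⟨C, hC, hCb⟩ := exists_eLpNorm_le_of_bound (μ := volume.restrict (Omega N))
      (two_le_critExp hN) two_ne_zero
      (Metric.isClosed_closedBall (x := (0 : Space N)) (ε := R)).measurableSet
      (isCompact_closedBall (0 : Space N) R).measure_lt_top.ne M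
    have hlim := h2.add (ENNReal.Tendsto.const_mul (a := C) h1 (Or.inr hC))
    rw [mul_zero, add_zero] at hlim
    refine tendsto_of_tendsto_of_tendsto_of_le_of_le tendsto_const_nhds hlim (fun _ => zero_le)
      fun n => ?_
    have e : (fun x => testCovGrad s (toComplex fun x => θ x * ψ n x) x -
        (((θ x : ℝ) : ℂ) • V x + w x • testCovGrad s (toComplex θ) x)) =
        (fun x => ((θ x : ℝ) : ℂ) • (testCovGrad 0 (toComplex (ψ n)) x - V x)) +
          fun x => (toComplex (ψ n) x - w x) • testCovGrad s (toComplex θ) x := by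
      ext1 x
      rw [testCovGrad_mul (hθ.differentiable (by simp) x) ((hψ n).1.differentiable (by simp) x),
        Pi.add_apply, smul_sub, sub_smul, toComplex]
      abel
    beta_reduce
    rw [e]
    refine (eLpNorm_add_le (hθm.smul ((hψV n).sub hV)) (((hψm n).sub hw).smul hqm)
      one_le_two).trans (add_le_add (eLpNorm_mono fun x => ?_) ?_)
    · change ‖((θ x : ℝ) : ℂ) • (testCovGrad 0 (toComplex (ψ n)) x - V x)‖ ≤ _
      rw [norm_smul, Complex.norm_real]
      exact mul_le_of_le_one_left (norm_nonneg _) (hθ1 x)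
    · refine hCb _ (fun x => toComplex (ψ n) x - w x) ((hψm n).sub hw) (fun x _ => ?_)
        fun x hx => ?_
      · change ‖(toComplex (ψ n) x - w x) • testCovGrad s (toComplex θ) x‖ ≤ _
        rw [norm_smul, mul_comm]
        exact mul_le_mul_of_nonneg_right (hM x) (norm_nonneg _)
      · change (toComplex (ψ n) x - w x) • testCovGrad s (toComplex θ) x = 0
        rw [hR x (by simpa using hx), smul_zero]

/-! ### The pointwise diamagnetic inequality for rotationally invariant functions -/

/-- Pythagoras: `regGrad` has real coordinates and the magnetic term of `|u|` has imaginary ones. -/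
theorem norm_regGrad_add_magneticTerm_sq (s : ℝ) (u : Space N → ℂ) (x : Space N)
    (p : EuclideanSpace ℂ (Fin 2 ⊕ Fin (N - 2))) :
    ‖regGrad 0 (u x) p + magneticTerm s (toComplex fun x => ‖u x‖) x‖ ^ 2 =
      ‖regGrad 0 (u x) p‖ ^ 2 + ‖magneticTerm s u x‖ ^ 2 := by
  have h : RCLike.re (inner ℂ (regGrad 0 (u x) p)
      (magneticTerm s (toComplex fun x => ‖u x‖) x)) = 0 := by
    rw [PiLp.inner_apply, map_sum]
    refine Finset.sum_eq_zero fun j _ => ?_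
    simp [regGrad, magneticTerm, toComplex]
  rw [norm_add_sq (𝕜 := ℂ), h, norm_magneticTerm, norm_magneticTerm]
  simp [toComplex]

/-- Pythagoras again: the hypothesis says that `p` has no angular component, while `𝔸` is purely
angular. -/
theorem norm_add_magneticTerm_sq {s : ℝ} {u : Space N → ℂ} {x : Space N}
    {p : EuclideanSpace ℂ (Fin 2 ⊕ Fin (N - 2))}
    (h : ((x (Sum.inl 1) : ℝ) : ℂ) * p (Sum.inl 0) = ((x (Sum.inl 0) : ℝ) : ℂ) * p (Sum.inl 1)) :
    ‖p + magneticTerm s u x‖ ^ 2 = ‖p‖ ^ 2 + ‖magneticTerm s u x‖ ^ 2 := by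
  have h0 : inner ℂ p (magneticTerm s u x) = 0 := by
    have hc := congrArg (starRingEnd ℂ) h
    simp only [map_mul, Complex.conj_ofReal] at hc
    rw [PiLp.inner_apply, Fintype.sum_sum_type, Fin.sum_univ_two]
    simp only [magneticTerm, potential_inl_zero, potential_inl_one, potential_inr,
      RCLike.inner_apply, Complex.ofReal_zero, mul_zero, zero_mul, Finset.sum_const_zero, add_zero]
    push_cast
    linear_combination (-(Complex.I * s * u x / (‖yPart x‖ : ℂ) ^ 2)) * hc
  rw [norm_add_sq (𝕜 := ℂ), h0]
  simp

theorem norm_regGrad_add_magneticTerm_le {s : ℝ} {u : Space N → ℂ} {x : Space N}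
    {p : EuclideanSpace ℂ (Fin 2 ⊕ Fin (N - 2))}
    (h : ((x (Sum.inl 1) : ℝ) : ℂ) * p (Sum.inl 0) = ((x (Sum.inl 0) : ℝ) : ℂ) * p (Sum.inl 1)) :
    ‖regGrad 0 (u x) (p + magneticTerm s u x) +
      magneticTerm s (toComplex fun x => ‖u x‖) x‖ ≤ ‖p + magneticTerm s u x‖ := by
  refine le_of_sq_le_sq ?_ (norm_nonneg _)
  rw [norm_regGrad_add_magneticTerm_sq, norm_add_magneticTerm_sq h, regGrad_add,
    regGrad_magneticTerm, add_zero]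
  have := pow_le_pow_left₀ (norm_nonneg _) (norm_regGrad_le 0 (u x) p) 2
  linarith

/-- Places `|s||u|/|y|` in `L²`, which supplies the majorant for removing the cut-offs. -/
theorem norm_magneticTerm_le {s : ℝ} {u : Space N → ℂ} {x : Space N}
    {p : EuclideanSpace ℂ (Fin 2 ⊕ Fin (N - 2))}
    (h : ((x (Sum.inl 1) : ℝ) : ℂ) * p (Sum.inl 0) = ((x (Sum.inl 0) : ℝ) : ℂ) * p (Sum.inl 1)) :
    ‖magneticTerm s u x‖ ≤ ‖p + magneticTerm s u x‖ := by
  refine le_of_sq_le_sq ?_ (norm_nonneg _)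
  rw [norm_add_magneticTerm_sq h]
  linarith [sq_nonneg ‖p‖]

/-! ### The modulus of a rotationally invariant function -/

theorem testCovGrad_cutoff_smul (s r : ℝ) (u : Space N → ℂ) (x : Space N) :
    toComplex (fun x => ‖u x‖) x • testCovGrad s (toComplex (cutoff r)) x =
      toComplex (fun x => ‖u x‖) x • grad (toComplex (cutoff r)) x +
        ((cutoff r x : ℝ) : ℂ) • magneticTerm s (toComplex fun x => ‖u x‖) x := by
  ext j
  simp [testCovGrad, magneticTerm, toComplex]
  ring

/-- The error of the cut-off is `(cutoff - 1)` times the covariant gradient of `|u|`, plus `|u|`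
times the gradient of the cut-off. The first is at most `|D|` and the second at most `C|u|/|y| ≤
(C/|s|)|D|`; this is where `s ≠ 0` enters. -/
theorem IsRealLimit.of_cutoff (hN : 3 ≤ N) {s : ℝ} (hs : s ≠ 0) {u : Space N → ℂ}
    {V D : Space N → EuclideanSpace ℂ (Fin 2 ⊕ Fin (N - 2))}
    (hu : MemLp u (ENNReal.ofReal (critExp N)) (volume.restrict (Omega N)))
    (hV : MemLp V 2 (volume.restrict (Omega N))) (hD : MemLp D 2 (volume.restrict (Omega N)))
    (hDu : ∀ᵐ x ∂(volume.restrict (Omega N)), ‖magneticTerm s u x‖ ≤ ‖D x‖)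
    (hVD : ∀ᵐ x ∂(volume.restrict (Omega N)),
      ‖V x + magneticTerm s (toComplex fun x => ‖u x‖) x‖ ≤ ‖D x‖)
    (h : IsRealLimit 0 (toComplex fun x => ‖u x‖) V) :
    IsRealLimit s (toComplex fun x => ‖u x‖)
      (fun x => V x + magneticTerm s (toComplex fun x => ‖u x‖) x) := by
  obtain ⟨C, hC0, hC⟩ := exists_norm_grad_cutoff_le (N := N)
  have hr : ∀ n : ℕ, (0 : ℝ) < n + 1 := fun n => by positivity
  have hrt : Tendsto (fun n : ℕ => (n : ℝ) + 1) atTop atTop :=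
    tendsto_atTop_add_const_right _ _ tendsto_natCast_atTop_atTop
  have hab : ∀ r, ∀ x : Space N, |cutoff r x| ≤ 1 := fun r x => by
    rw [abs_of_nonneg (cutoff_nonneg r x)]
    exact cutoff_le_one r x
  have hnm : AEStronglyMeasurable (toComplex fun x => ‖u x‖) (volume.restrict (Omega N)) :=
    Complex.continuous_ofReal.comp_aestronglyMeasurable hu.1.norm
  have hcm : ∀ r, AEStronglyMeasurable (toComplex (cutoff r)) (volume.restrict (Omega N)) :=
    fun r => (Complex.continuous_ofReal.comp (contDiff_cutoff r).continuous).aestronglyMeasurable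
  have hgm : ∀ r, AEStronglyMeasurable (testCovGrad s (toComplex (cutoff r)))
      (volume.restrict (Omega N)) := fun r =>
    (continuous_grad (Complex.ofRealCLM.contDiff.comp (contDiff_cutoff r))).aestronglyMeasurable.add
      (aestronglyMeasurable_magneticTerm (hcm r))
  have hzero : ∀ r > 0, ∀ x : Space N, 2 * r < ‖x‖ ∨ r * ‖yPart x‖ < 1 →
      testCovGrad s (toComplex (cutoff r)) x = 0 := fun r hr x hx => by
    have h0 := cutoff_grad_eq_zero hr hx
    rw [testCovGrad, h0.2]
    ext j
    simp [magneticTerm, toComplex, h0.1]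
  -- The covariant gradient lives where `|y| ≥ 1/r`, and is at most `(C + |s|)/|y|` there.
  -- Dependence on `r` is harmless, as `r` is fixed while the real approximants converge.
  have hbound : ∀ r > 0, ∀ x : Space N,
      ‖testCovGrad s (toComplex (cutoff r)) x‖ ≤ (C + |s|) * r := fun r hr x => by
    by_cases hx : r * ‖yPart x‖ < 1
    · rw [hzero r hr x (Or.inr hx), norm_zero]
      positivity
    · push Not at hx
      have hy : 0 < ‖yPart x‖ := by
        by_contra hy
        have : r * ‖yPart x‖ ≤ 0 := mul_nonpos_of_nonneg_of_nonpos hr.le (not_lt.1 hy)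
        linarith
      have hinv : ‖yPart x‖⁻¹ ≤ r := by
        rw [inv_le_iff_one_le_mul₀ hy]
        exact hx
      have h1 : ‖magneticTerm s (toComplex (cutoff r)) x‖ ≤ |s| * ‖yPart x‖⁻¹ := by
        rw [norm_magneticTerm, toComplex, Complex.norm_real, div_eq_mul_inv]
        gcongr
        exact mul_le_of_le_one_left (by positivity) (hab r x)
      calc _ ≤ C * ‖yPart x‖⁻¹ + |s| * ‖yPart x‖⁻¹ := (norm_add_le _ _).trans
            (add_le_add (hC r hr x) h1)
        _ = (C + |s|) * ‖yPart x‖⁻¹ := by ring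
        _ ≤ (C + |s|) * r := by gcongr
  refine IsRealLimit.of_tendsto hN (fun n : ℕ => h.mul_left hN hnm hV.1
      (contDiff_cutoff ((n : ℝ) + 1)) (hab _) (hbound _ (hr n))
      (fun x hx => hzero _ (hr n) x (Or.inl hx)))
    (fun n => (hcm _).mul hnm) (fun n => ((hcm _).smul hV.1).add (hnm.smul (hgm _)))
    hnm (hV.1.add (aestronglyMeasurable_magneticTerm hnm)) ?_ ?_
  · refine tendsto_eLpNorm_zero_of_dominated (critExp_ne_zero hN) ENNReal.ofReal_ne_top
      (fun n => ((hcm _).mul hnm).sub hnm) hu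
      (fun n => Eventually.of_forall fun x => ?_) ?_
    · have h1 := cutoff_nonneg ((n : ℝ) + 1) x
      have h2 := cutoff_le_one ((n : ℝ) + 1) x
      simp only [toComplex, ← Complex.ofReal_mul, ← Complex.ofReal_sub, Complex.norm_real,
        Real.norm_eq_abs]
      rw [← sub_one_mul, abs_mul, abs_norm]
      refine mul_le_of_le_one_left (norm_nonneg _) ?_
      rw [abs_le]
      constructor <;> linarith
    · filter_upwards [ae_restrict_mem isOpen_Omega.measurableSet] with x hx
      refine tendsto_const_nhds.congr' ?_
      filter_upwards [hrt.eventually (eventually_cutoff_eq_one hx)] with n hn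
      simp [hn.1]
  · refine tendsto_eLpNorm_zero_of_dominated two_ne_zero ENNReal.ofNat_ne_top
      (fun n => (((hcm _).smul hV.1).add (hnm.smul (hgm _))).sub
        (hV.1.add (aestronglyMeasurable_magneticTerm hnm)))
      (hD.const_smul (1 + C / |s|)) (fun n => ?_) ?_
    · filter_upwards [hDu, hVD] with x h1 h2
      set t := cutoff ((n : ℝ) + 1) x with ht
      have e : ((t : ℝ) : ℂ) • V x + toComplex (fun x => ‖u x‖) x •
            testCovGrad s (toComplex (cutoff ((n : ℝ) + 1))) x -
          (V x + magneticTerm s (toComplex fun x => ‖u x‖) x) =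
          (((t - 1 : ℝ) : ℂ) • (V x + magneticTerm s (toComplex fun x => ‖u x‖) x)) +
            toComplex (fun x => ‖u x‖) x • grad (toComplex (cutoff ((n : ℝ) + 1))) x := by
        rw [testCovGrad_cutoff_smul, ← ht, Complex.ofReal_sub, Complex.ofReal_one, sub_smul,
          one_smul, smul_add]
        abel
      have h3 : ‖toComplex (fun x => ‖u x‖) x • grad (toComplex (cutoff ((n : ℝ) + 1))) x‖ ≤
          C / |s| * ‖D x‖ := by
        rw [norm_smul, toComplex, Complex.norm_real, norm_norm]
        have hs' : 0 < |s| := abs_pos.2 hs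
        calc _ ≤ ‖u x‖ * (C * ‖yPart x‖⁻¹) := by
              gcongr
              exact hC _ (hr n) x
          _ = C / |s| * ‖magneticTerm s u x‖ := by
              rw [norm_magneticTerm]
              field_simp
          _ ≤ _ := by gcongr
      have h4 : ‖((t - 1 : ℝ) : ℂ)‖ ≤ 1 := by
        rw [Complex.norm_real, Real.norm_eq_abs, abs_le]
        have := cutoff_nonneg ((n : ℝ) + 1) x
        have := cutoff_le_one ((n : ℝ) + 1) x
        constructor <;> linarith
      have h5 : 0 ≤ 1 + C / |s| := by positivity
      change ‖((t : ℝ) : ℂ) • V x + toComplex (fun x => ‖u x‖) x •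
            testCovGrad s (toComplex (cutoff ((n : ℝ) + 1))) x -
          (V x + magneticTerm s (toComplex fun x => ‖u x‖) x)‖ ≤ ‖(1 + C / |s|) • D x‖
      rw [e, norm_smul (1 + C / |s|), Real.norm_of_nonneg h5, one_add_mul]
      refine (norm_add_le _ _).trans (add_le_add ?_ h3)
      rw [norm_smul]
      exact (mul_le_of_le_one_left (norm_nonneg _) h4).trans h2
    · filter_upwards [ae_restrict_mem isOpen_Omega.measurableSet] with x hx
      refine tendsto_const_nhds.congr' ?_
      filter_upwards [hrt.eventually (eventually_cutoff_eq_one hx)] with n hn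
      change (0 : EuclideanSpace ℂ (Fin 2 ⊕ Fin (N - 2))) =
        ((cutoff ((n : ℝ) + 1) x : ℝ) : ℂ) • V x + toComplex (fun x => ‖u x‖) x •
            testCovGrad s (toComplex (cutoff ((n : ℝ) + 1))) x -
          (V x + magneticTerm s (toComplex fun x => ‖u x‖) x)
      rw [testCovGrad_cutoff_smul, hn.1, hn.2]
      simp

theorem IsRealLimit.isWeakGrad (hN : 3 ≤ N) {w : Space N → ℂ}
    {V : Space N → EuclideanSpace ℂ (Fin 2 ⊕ Fin (N - 2))}
    (hw : MemLp w (ENNReal.ofReal (critExp N)) (volume.restrict (Omega N)))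
    (hV : MemLp V 2 (volume.restrict (Omega N))) (h : IsRealLimit 0 w V) : IsWeakGrad w V := by
  obtain ⟨ψ, hψ, h1, h2⟩ := h.exists_seq
  simp only [testCovGrad_zero] at h2
  exact isWeakGrad_of_tendsto (one_le_critExp hN) one_le_two
    (fun n => (hψ n).toComplex.isWeakGrad) (fun n => (hψ n).toComplex.memLp _ _) hw
    (fun n => memLp_grad (hψ n).toComplex _ _) hV h1 h2

/-- Both conclusions rest on identifying the weak gradient of `|u|` with `regGrad 0 u (covGrad s
u)`, which the approximation at parameter `0` provides. -/
theorem norm_mem_DReal (hN : 3 ≤ N) {s : ℝ} {u : Space N → ℂ} (hu : u ∈ DComplex N s)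
    (hinv : ∀ c : Circle, ∀ᵐ x ∂(volume.restrict (Omega N)), u (act c 1 x) = u x) :
    (fun x => ‖u x‖) ∈ DReal N s ∧ ∀ᵐ x ∂(volume.restrict (Omega N)),
      ‖covGrad s (toComplex fun x => ‖u x‖) x‖ ≤ ‖covGrad s u x‖ := by
  obtain ⟨huL, hex, φ, hφ, h1, h2⟩ := hu
  have hv := isWeakGrad_weakGrad hex
  have hDm : AEStronglyMeasurable (covGrad s u) (volume.restrict (Omega N)) :=
    hv.2.1.aestronglyMeasurable.add (aestronglyMeasurable_magneticTerm huL.1)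
  have hD : MemLp (covGrad s u) 2 (volume.restrict (Omega N)) :=
    MemLp.of_tendsto_eLpNorm_sub (fun n => memLp_testCovGrad (hφ n) s 2 _) hDm h2
  have hang := hv.angular_eq_zero hinv
  have hlim := isRealLimit_norm hN huL hD hφ h1 h2
  have hV : MemLp (fun x => regGrad 0 (u x) (covGrad s u x)) 2 (volume.restrict (Omega N)) :=
    hD.mono (aestronglyMeasurable_regGrad huL.1 hDm)
      (Eventually.of_forall fun x => norm_regGrad_le _ _ _)
  have hnL : MemLp (toComplex fun x => ‖u x‖) (ENNReal.ofReal (critExp N))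
      (volume.restrict (Omega N)) := huL.norm.ofReal
  have hw := hlim.isWeakGrad hN hnL hV
  have hcov : covGrad s (toComplex fun x => ‖u x‖) =ᵐ[volume.restrict (Omega N)]
      fun x => regGrad 0 (u x) (covGrad s u x) + magneticTerm s (toComplex fun x => ‖u x‖) x := by
    filter_upwards [(isWeakGrad_weakGrad ⟨_, hw⟩).ae_eq hw] with x hx
    rw [covGrad, hx]
  have hdia : ∀ᵐ x ∂(volume.restrict (Omega N)), ‖regGrad 0 (u x) (covGrad s u x) +
      magneticTerm s (toComplex fun x => ‖u x‖) x‖ ≤ ‖covGrad s u x‖ := by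
    filter_upwards [hang] with x hx using norm_regGrad_add_magneticTerm_le hx
  refine ⟨⟨hnL, ⟨_, hw⟩, ?_⟩, ?_⟩
  · have hlim' : IsRealLimit s (toComplex fun x => ‖u x‖) (fun x =>
        regGrad 0 (u x) (covGrad s u x) + magneticTerm s (toComplex fun x => ‖u x‖) x) := by
      -- For `s = 0` the approximation obtained so far is already the required one, and no cut-off
      -- is needed.
      rcases eq_or_ne s 0 with rfl | hs
      · have : ∀ x, magneticTerm 0 (toComplex fun x => ‖u x‖) x = 0 := fun x => by
          ext j
          simp [magneticTerm]
        simpa only [this, add_zero] using hlim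
      · refine hlim.of_cutoff hN hs huL hV hD ?_ hdia
        filter_upwards [hang] with x hx using norm_magneticTerm_le hx
    obtain ⟨ψ, hψ, g1, g2⟩ := hlim'.exists_seq
    refine ⟨fun n => toComplex (ψ n), fun n => ⟨ψ n, hψ n, rfl⟩, g1, g2.congr fun n => ?_⟩
    refine eLpNorm_congr_ae ?_
    filter_upwards [hcov] with x hx
    rw [hx]
  · filter_upwards [hcov, hdia] with x hx h
    rwa [hx]

/-! ### Comparison of the two infima -/

theorem norm_mem_admissibleReal (hN : 3 ≤ N) {s : ℝ} {Γ : Subgroup (OrthGroup (N - 2))}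
    {u : Space N → ℂ} (hu : u ∈ admissibleComplex s Γ) :
    (fun x => ‖u x‖) ∈ admissibleReal s Γ := by
  refine ⟨(norm_mem_DReal hN hu.1 fun c => hu.2.1 c 1 Γ.one_mem).1, fun c h hh => ?_,
    fun h0 => hu.2.2 ?_⟩
  · filter_upwards [hu.2.1 c h hh] with x hx
    rw [hx]
  · filter_upwards [h0] with x hx
    exact norm_eq_zero.1 hx

/-- The denominator and the Hardy term are unchanged, so only the covariant gradients are compared.
The sign of `σ` and an infinite Hardy integral play no role. -/
theorem quotient_norm_le (hN : 3 ≤ N) {s σ : ℝ} {Γ : Subgroup (OrthGroup (N - 2))}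
    {u : Space N → ℂ} (hu : u ∈ admissibleComplex s Γ) :
    quotient s σ (toComplex fun x => ‖u x‖) ≤ quotient s σ u := by
  have hle := (norm_mem_DReal hN hu.1 fun c => hu.2.1 c 1 Γ.one_mem).2
  have hc : critNorm (toComplex fun x => ‖u x‖) = critNorm u := by
    rw [critNorm, critNorm]
    congr 1
    exact eLpNorm_congr_norm_ae (Eventually.of_forall fun x => by simp [toComplex])
  rw [quotient, quotient, hc]
  refine EReal.div_le_div_right_of_nonneg (EReal.coe_nonneg.2 (sq_nonneg _)) ?_
  refine EReal.sub_le_sub ?_ (le_of_eq ?_)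
  · refine EReal.coe_ennreal_le_coe_ennreal_iff.2 (lintegral_mono_ae ?_)
    filter_upwards [hle] with x hx
    exact pow_le_pow_left' (enorm_le_iff_norm_le.2 hx) 2
  · simp [toComplex]

theorem toComplex_mem_admissibleComplex {s : ℝ} {Γ : Subgroup (OrthGroup (N - 2))}
    {u : Space N → ℝ} (hu : u ∈ admissibleReal s Γ) : toComplex u ∈ admissibleComplex s Γ := by
  obtain ⟨⟨h1, h2, φ, hφ, h3⟩, hinv, h0⟩ := hu
  refine ⟨⟨h1, h2, φ, fun n => ?_, h3⟩, fun c h hh => ?_, fun h => h0 ?_⟩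
  · obtain ⟨ψ, hψ, e⟩ := hφ n
    rw [e]
    exact hψ.toComplex
  · filter_upwards [hinv c h hh] with x hx
    rw [toComplex, toComplex, hx]
  · filter_upwards [h] with x hx
    exact Complex.ofReal_eq_zero.1 hx

theorem infComplex_eq_infReal (hN : 3 ≤ N) (s σ : ℝ) (Γ : Subgroup (OrthGroup (N - 2))) :
    infComplex s σ Γ = infReal s σ Γ := by
  refine le_antisymm (le_iInf₂ fun u hu => ?_) (le_iInf₂ fun u hu => ?_)
  · exact iInf₂_le (toComplex u) (toComplex_mem_admissibleComplex hu)
  · exact (iInf₂_le (fun x => ‖u x‖) (norm_mem_admissibleReal hN hu)).trans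
      (quotient_norm_le hN hu)

end AharonovBohm

theorem lemma4p1 (N : ℕ) (hN : 3 ≤ N) (s σ : ℝ) (hσ : σ < AharonovBohm.hardyConst N s)
    (Γ : Subgroup (AharonovBohm.OrthGroup (N - 2))) :
    AharonovBohm.infComplex s σ Γ = AharonovBohm.infReal s σ Γ ∧
    ∀ u : AharonovBohm.Space N → ℂ,
      u ∈ AharonovBohm.admissibleComplex s Γ →
      AharonovBohm.quotient s σ u = AharonovBohm.infComplex s σ Γ →
      (fun x => ‖u x‖) ∈ AharonovBohm.admissibleReal s Γ ∧
      AharonovBohm.quotient s σ (AharonovBohm.toComplex fun x => ‖u x‖) =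
        AharonovBohm.infReal s σ Γ := by
  have heq := AharonovBohm.infComplex_eq_infReal hN s σ Γ
  refine ⟨heq, fun u hu hmin => ?_⟩
  have hmem := AharonovBohm.norm_mem_admissibleReal hN hu
  refine ⟨hmem, le_antisymm ?_ (iInf₂_le (fun x => ‖u x‖) hmem)⟩
  exact (AharonovBohm.quotient_norm_le hN hu).trans_eq (hmin.trans heq)
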